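/- Let $\mathcal F_M=\ell^2(\mathbb N^M)$ be the Fock space of $M$ bosonic modes with annihilation operators $\hat a_1,\dots,\hat a_M$, and let $\hat a_i,\hat a_i^\dagger$ be considered on their common domain, the states of finite mean total photon number. A unitary $\hat G$ on $\mathcal F_M$ that preserves this domain (that is, $\hat G\psi$ lies in it if and only if $\psi$ does) is called a *Gaussian unitary* (without displacement) if there are complex $M\times M$ matrices $A,B$ (its Bogoliubov matrices) with $$\hat G^\dagger\hat a_i\hat G=\sum_{k=1}^M\bigl(A_{ik}\hat a_k+B_{ik}\hat a_k^\dagger\bigr)\qquad(1\le i\le M).$$ It is a *linear-optical circuit* if moreover $B=0$ and $A$ is a unitary matrix. For $\boldsymbol r\in\mathbb R^M$ let $\hat S(\boldsymbol r)=\bigotimes_i\hat S(r_i)$ be the product of the single-mode squeezing gates, that is, the unitary with $\hat S(\boldsymbol r)^\dagger\hat a_i\hat S(\boldsymbol r)=\cosh r_i\,\hat a_i+\sinh r_i\,\hat a_i^\dagger$ for all $i$, with its global phase fixed by $\langle 0|\hat S(\boldsymbol r)|0\rangle>0$. For $\boldsymbol\varphi\in\mathbb R^M$ let $\hat P(\boldsymbol\varphi)=e^{i\sum_j\varphi_j\hat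 n_j}$ be the phase shifter, $\hat P(\boldsymbol\varphi)|\boldsymbol n\rangle=e^{i\boldsymbol\varphi\cdot\boldsymbol n}|\boldsymbol n\rangle$. **Lemma (Bloch-Messiah decomposition and low-rank structure).** Let $\hat G_0$ be a Gaussian unitary on $M$ modes (without displacement), and let $\boldsymbol\varphi\in\mathbb R^M$ have at most $L$ nonzero entries. Put $\hat G=\hat G_0^\dagger\hat P(\boldsymbol\varphi)\hat G_0$. Then: 1. There are linear-optical circuits $\hat U,\hat V$ and $\boldsymbol r\in\mathbb R^M$ with at most $2L$ nonzero entries such that $\hat G=\hat U\,\hat S(\boldsymbol r)\,\hat V$. 2. There are complex $M\times M$ matrices $W,Z$ with $\operatorname{rank}W\le 2L$ and $\operatorname{rank}Z\le 2L$ such that $$\hat G^\dagger\hat a_i\hat G=\hat a_i+\sum_{k=1}^M\bigl(W_{ik}\hat a_k+Z_{ik}\hat a_k^\dagger\bigr)\qquad(1\le i\le M),$$ that is, the Bogoliubov matrices of $\hat G$ are $I+W$ and $Z$. -/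

import Mathlib

open scoped Matrix

noncomputable section

namespace Bosonic

/-- The `M`-mode bosonic Fock space, as square-summable sequences of amplitudes in the
occupation-number basis `|n₁, …, n_M⟩`. -/
abbrev Fock (M : ℕ) : Type := lp (fun _ : Fin M → ℕ => ℂ) 2

variable {M : ℕ}

theorem memℓp_two_iff {ι : Type*} (f : ι → ℂ) :
    Memℓp f 2 ↔ Summable fun n => ‖f n‖ ^ 2 := by
  rw [memℓp_gen_iff (by norm_num)]
  norm_num

/-- The amplitudes of `N^{1/2} ψ`, where `N` is the total photon number operator. -/
def sqrtNumber (ψ : Fock M) (n : Fin M → ℕ) : ℂ :=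
  (Real.sqrt ((∑ i, n i : ℕ) : ℝ) : ℂ) * ψ n

/-- The states of finite mean total photon number, `∑ₙ (n₁ + ⋯ + n_M) |ψ(n)|² < ∞`. It is the
common domain of all annihilation and creation operators. -/
def finiteEnergy (M : ℕ) : Submodule ℂ (Fock M) where
  carrier := {ψ | Memℓp (sqrtNumber ψ) 2}
  zero_mem' := by
    have h : sqrtNumber (0 : Fock M) = 0 := by
      funext n; simp [sqrtNumber]
    simp only [Set.mem_ofPred_eq, h]
    exact zero_memℓp
  add_mem' := by
    intro ψ χ hψ hχ
    have h : sqrtNumber (ψ + χ) = sqrtNumber ψ + sqrtNumber χ := by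
      funext n; simp [sqrtNumber, mul_add]
    simp only [Set.mem_ofPred_eq, h] at *
    exact hψ.add hχ
  smul_mem' := by
    intro c ψ hψ
    have h : sqrtNumber (c • ψ) = c • sqrtNumber ψ := by
      funext n; simp [sqrtNumber, mul_left_comm]
    simp only [Set.mem_ofPred_eq, h] at *
    exact hψ.const_smul c

/-- Adding one photon in mode `i`. -/
def addPhoton (i : Fin M) (n : Fin M → ℕ) : Fin M → ℕ := Function.update n i (n i + 1)

/-- Removing one photon in mode `i` (only used where `1 ≤ n i`). -/
def removePhoton (i : Fin M) (n : Fin M → ℕ) : Fin M → ℕ := Function.update n i (n i - 1)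

theorem addPhoton_apply_self (i : Fin M) (n : Fin M → ℕ) : addPhoton i n i = n i + 1 := by
  simp [addPhoton]

theorem removePhoton_addPhoton (i : Fin M) (n : Fin M → ℕ) :
    removePhoton i (addPhoton i n) = n := by
  simp [removePhoton, addPhoton]

theorem addPhoton_removePhoton (i : Fin M) (n : Fin M → ℕ) (h : n i ≠ 0) :
    addPhoton i (removePhoton i n) = n := by
  have h' : n i - 1 + 1 = n i := by omega
  simp [removePhoton, addPhoton, h']

theorem addPhoton_injective (i : Fin M) : Function.Injective (addPhoton (M := M) i) :=
  Function.LeftInverse.injective (removePhoton_addPhoton i)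

theorem summable_number_mul {ψ : Fock M} (hψ : ψ ∈ finiteEnergy M) (i : Fin M) :
    Summable fun n => (n i : ℝ) * ‖ψ n‖ ^ 2 := by
  have h : Summable fun n => ‖sqrtNumber ψ n‖ ^ 2 := (memℓp_two_iff _).1 hψ
  refine Summable.of_nonneg_of_le (fun n => by positivity) (fun n => ?_) h
  have h1 : ‖sqrtNumber ψ n‖ ^ 2 = ((∑ j, n j : ℕ) : ℝ) * ‖ψ n‖ ^ 2 := by
    rw [sqrtNumber, norm_mul, mul_pow, Complex.norm_real, Real.norm_eq_abs, sq_abs,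
      Real.sq_sqrt (by positivity)]
  rw [h1]
  have h2 : n i ≤ ∑ j, n j := Finset.single_le_sum (fun _ _ => Nat.zero_le _) (Finset.mem_univ i)
  gcongr

theorem summable_norm_sq (ψ : Fock M) : Summable fun n => ‖ψ n‖ ^ 2 :=
  (memℓp_two_iff _).1 (lp.memℓp ψ)

/-- The annihilation operator `aᵢ |n⟩ = √nᵢ |n - eᵢ⟩`; on amplitudes,
`(aᵢ ψ)(n) = √(nᵢ + 1) ψ(n + eᵢ)`. -/
def annihilation (i : Fin M) : finiteEnergy M →ₗ[ℂ] Fock M where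
  toFun ψ := ⟨fun n => (Real.sqrt ((n i : ℝ) + 1) : ℂ) * (ψ : Fock M) (addPhoton i n), by
    refine (memℓp_two_iff _).2 ?_
    have h := (summable_number_mul ψ.2 i).comp_injective (addPhoton_injective i)
    refine h.congr fun n => ?_
    rw [norm_mul, mul_pow, Complex.norm_real, Real.norm_eq_abs, sq_abs,
      Real.sq_sqrt (by positivity)]
    simp [addPhoton_apply_self]⟩
  map_add' ψ χ := by
    ext n; simp [mul_add]; rfl
  map_smul' c ψ := by
    ext n; simp [mul_left_comm]

/-- The creation operator `aᵢ† |n⟩ = √(nᵢ + 1) |n + eᵢ⟩`; on amplitudes,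
`(aᵢ† ψ)(n) = √nᵢ ψ(n - eᵢ)`, which is `0` when `nᵢ = 0`. -/
def creation (i : Fin M) : finiteEnergy M →ₗ[ℂ] Fock M where
  toFun ψ := ⟨fun n => (Real.sqrt (n i : ℝ) : ℂ) * (ψ : Fock M) (removePhoton i n), by
    refine (memℓp_two_iff _).2 ?_
    have h : Summable fun n => ((n i : ℝ) + 1) * ‖(ψ : Fock M) n‖ ^ 2 := by
      refine ((summable_number_mul ψ.2 i).add (summable_norm_sq (ψ : Fock M))).congr fun n => ?_
      ring
    rw [← (addPhoton_injective i).summable_iff]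
    · refine h.congr fun n => ?_
      simp only [Function.comp_apply, removePhoton_addPhoton]
      rw [norm_mul, mul_pow, Complex.norm_real, Real.norm_eq_abs, sq_abs,
        Real.sq_sqrt (by positivity), addPhoton_apply_self]
      push_cast
      ring
    · intro n hn
      have h0 : n i = 0 := by
        by_contra h0
        exact hn ⟨removePhoton i n, addPhoton_removePhoton i n h0⟩
      simp [h0]⟩
  map_add' ψ χ := by
    ext n; simp [mul_add]; rfl
  map_smul' c ψ := by
    ext n; simp [mul_left_comm]

/-- The vacuum state `|0, …, 0⟩`. -/
def vacuum (M : ℕ) : Fock M := lp.single 2 (0 : Fin M → ℕ) (1 : ℂ)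

/-- `G† aᵢ G = ∑ⱼ (Aᵢⱼ aⱼ + Bᵢⱼ aⱼ†)` for all `i`, as an identity of operators on the common
domain of the annihilation and creation operators, which `G` preserves. The matrices `A`, `B` are
the Bogoliubov matrices of the unitary `G`. -/
structure HasBogoliubov (G : Fock M ≃ₗᵢ[ℂ] Fock M) (A B : Matrix (Fin M) (Fin M) ℂ) : Prop where
  mem_iff : ∀ ψ : Fock M, G ψ ∈ finiteEnergy M ↔ ψ ∈ finiteEnergy M
  conj : ∀ (i : Fin M) (ψ : finiteEnergy M),
    annihilation i ⟨G ψ, (mem_iff ψ).2 ψ.2⟩ =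
      G (∑ j, (A i j • annihilation j ψ + B i j • creation j ψ))

/-- A Gaussian unitary (without displacement): it maps each annihilation operator to a linear
combination of annihilation and creation operators. -/
def IsGaussianUnitary (G : Fock M ≃ₗᵢ[ℂ] Fock M) : Prop :=
  ∃ A B : Matrix (Fin M) (Fin M) ℂ, HasBogoliubov G A B

/-- A linear-optical circuit: `G† aᵢ G = ∑ⱼ Uᵢⱼ aⱼ` for a unitary matrix `U`. -/
def IsLinearOptical (G : Fock M ≃ₗᵢ[ℂ] Fock M) : Prop :=
  ∃ U ∈ Matrix.unitaryGroup (Fin M) ℂ, HasBogoliubov G U 0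

/-- `S` is the tensor product `S(r₁) ⊗ ⋯ ⊗ S(r_M)` of the single-mode squeezing gates
`S(rᵢ) = exp (rᵢ (aᵢ†² - aᵢ²) / 2)`. It is the unitary with `S† aᵢ S = cosh rᵢ aᵢ + sinh rᵢ aᵢ†`;
this fixes `S` up to a global phase, and the phase is fixed by `⟨0|S|0⟩ > 0`
(for the exponential, `⟨0|S|0⟩ = ∏ᵢ (cosh rᵢ) ^ (-1/2)`). -/
structure IsSqueezing (r : Fin M → ℝ) (S : Fock M ≃ₗᵢ[ℂ] Fock M) : Prop where
  bogoliubov : HasBogoliubov S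
    (Matrix.diagonal fun i => (Real.cosh (r i) : ℂ))
    (Matrix.diagonal fun i => (Real.sinh (r i) : ℂ))
  vacuum_pos : ∃ c : ℝ, 0 < c ∧ inner ℂ (vacuum M) (S (vacuum M)) = (c : ℂ)

/-- The eigenvalue `exp (i φ · n)` of the phase shifter on the Fock state `|n⟩`. -/
def phase (φ : Fin M → ℝ) (n : Fin M → ℕ) : ℂ :=
  Complex.exp (((∑ i, φ i * (n i : ℝ) : ℝ) : ℂ) * Complex.I)

theorem norm_phase (φ : Fin M → ℝ) (n : Fin M → ℕ) : ‖phase φ n‖ = 1 :=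
  Complex.norm_exp_ofReal_mul_I _

theorem phase_neg_mul_phase (φ : Fin M → ℝ) (n : Fin M → ℕ) :
    phase (-φ) n * phase φ n = 1 := by
  rw [phase, phase, ← Complex.exp_add, Complex.exp_eq_one_iff]
  exact ⟨0, by simp⟩

theorem memℓp_phase_mul (φ : Fin M → ℝ) (ψ : Fock M) :
    Memℓp (fun n => phase φ n * ψ n) 2 := by
  refine (memℓp_two_iff _).2 ((summable_norm_sq ψ).congr fun n => ?_)
  rw [norm_mul, norm_phase, one_mul]

/-- The phase shifter `P(φ) = exp (i φ · n̂)`, acting by `P(φ) |n⟩ = exp (i φ · n) |n⟩`. -/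
def phaseShifter (φ : Fin M → ℝ) : Fock M ≃ₗᵢ[ℂ] Fock M where
  toFun ψ := ⟨fun n => phase φ n * ψ n, memℓp_phase_mul φ ψ⟩
  invFun ψ := ⟨fun n => phase (-φ) n * ψ n, memℓp_phase_mul (-φ) ψ⟩
  left_inv ψ := by
    ext n
    simp [← mul_assoc, phase_neg_mul_phase]
  right_inv ψ := by
    ext n
    have h := phase_neg_mul_phase (-φ) n
    rw [neg_neg] at h
    simp [← mul_assoc, h]
  map_add' ψ χ := by
    ext n; simp [mul_add]; rfl
  map_smul' c ψ := by
    ext n; simp [mul_left_comm]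
  norm_map' ψ := by
    rw [lp.norm_eq_tsum_rpow (by norm_num), lp.norm_eq_tsum_rpow (by norm_num)]
    congr 1
    refine tsum_congr fun n => ?_
    simp [norm_phase]

end Bosonic

end

open scoped Matrix

noncomputable section

namespace Bosonic

variable {M : ℕ}

/-! Because a Gaussian unitary preserves the commutation relations, its Bogoliubov matrices satisfy
A A† − B B† = 1 and A Bᵀ = B Aᵀ. So the block matrix with rows (A, B) and (B̄, Ā) has the inverse
with rows (A†, −Bᵀ) and (−B†, Aᵀ), and products of unitaries correspond to products of block
matrices. A phase shifter has the blocks 1 + D and 1 + D̄, where D is diagonal and vanishes wherever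
φ does. Conjugation turns them into 1 + W and Z with W = A†DA − BᵀD̄B̄ and Z = A†DB − BᵀD̄Ā, sums of
two terms of rank at most L each (`HasBogoliubov.conj_phaseShifter`).

The decomposition is first proved for matrices (`IsBogoliubovPair.exists_blochMessiah`): A⁻¹B is
symmetric, and its Takagi values have the form tanh rᵢ, which gives A = u cosh(r) v and B = u
sinh(r) v̄. Since sinh vanishes only at 0, the rank of B counts the nonzero rᵢ. To lift this to Fock
space, only v and the squeezing need to be implemented: the remaining factor U = G V⁻¹ S⁻¹ then has
Bogoliubov matrices (u, 0), and the global phase goes into it.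

The implementation is the analytic part (`IsBogoliubovPair.exists_unitary`). By the commutation
relations alone, polynomials in creation operators applied to a normalized vacuum have fixed inner
products, so sending p(a†)|0⟩ to p(b†)Ω is isometric. The isometries for a transformation and for
its inverse compose to an operator that commutes with all aᵢ and aᵢ†, hence to a scalar, and so they
are onto. The required vacua are |0⟩ for linear optics and an explicit squeezed vacuum for
squeezing. Both lie in the space of geometrically decaying amplitudes, where all products of ladder
operators are defined. -/

/-! ### Ladder operators and number states -/

theorem annihilation_apply (i : Fin M) (ψ : finiteEnergy M) (n : Fin M → ℕ) :
    annihilation i ψ n = (Real.sqrt ((n i : ℝ) + 1) : ℂ) * (ψ : Fock M) (addPhoton i n) := rfl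

theorem creation_apply (i : Fin M) (ψ : finiteEnergy M) (n : Fin M → ℕ) :
    creation i ψ n = (Real.sqrt (n i : ℝ) : ℂ) * (ψ : Fock M) (removePhoton i n) := rfl

/-- A state has finite energy as soon as each formal `aᵢ ψ` is square-summable. -/
theorem mem_finiteEnergy_of_annihilation {ψ : Fock M} (χ : Fin M → Fock M)
    (h : ∀ i n, (Real.sqrt ((n i : ℝ) + 1) : ℂ) * ψ (addPhoton i n) = χ i n) :
    ψ ∈ finiteEnergy M := by
  have h1 : ∀ i, Summable fun n : Fin M → ℕ => (n i : ℝ) * ‖ψ n‖ ^ 2 := by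
    intro i
    rw [← (addPhoton_injective i).summable_iff]
    · refine (summable_norm_sq (χ i)).congr fun n => ?_
      rw [← h, norm_mul, mul_pow, Complex.norm_real, Real.norm_eq_abs, sq_abs,
        Real.sq_sqrt (by positivity)]
      simp [addPhoton_apply_self]
    · intro n hn
      have h0 : n i = 0 := by
        by_contra h0
        exact hn ⟨removePhoton i n, addPhoton_removePhoton i n h0⟩
      simp [h0]
  refine (memℓp_two_iff _).2 ((summable_sum fun i (_ : i ∈ Finset.univ) => h1 i).congr fun n => ?_)
  rw [sqrtNumber, norm_mul, mul_pow, Complex.norm_real, Real.norm_eq_abs, sq_abs,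
    Real.sq_sqrt (by positivity), ← Finset.sum_mul]
  push_cast
  rfl

/-- The occupation-number state `|n⟩`. -/
def ket (n : Fin M → ℕ) : Fock M := lp.single 2 n (1 : ℂ)

theorem ket_apply (n m : Fin M → ℕ) : (ket n : Fock M) m = if m = n then 1 else 0 := by
  rw [ket, lp.single_apply, Pi.single_apply]

theorem ket_apply_self (n : Fin M → ℕ) : (ket n : Fock M) n = 1 := by simp [ket_apply]

theorem ket_mem (n : Fin M → ℕ) : ket n ∈ finiteEnergy M := by
  refine (memℓp_two_iff _).2 (summable_of_ne_finset_zero (s := {n}) fun m hm => ?_)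
  have : m ≠ n := by simpa using hm
  simp [sqrtNumber, ket_apply, this]

/-- The occupation-number state `|n⟩` as a state of finite energy. -/
def ketE (n : Fin M → ℕ) : finiteEnergy M := ⟨ket n, ket_mem n⟩

theorem inner_ket (n : Fin M → ℕ) (ψ : Fock M) : inner ℂ (ket n) ψ = ψ n := by
  rw [ket, lp.inner_single_left]; simp

theorem hasSum_ket (ψ : Fock M) : HasSum (fun n => ψ n • (ket n : Fock M)) ψ := by
  convert lp.hasSum_single (p := 2) (by norm_num) ψ using 2 with n
  rw [ket, ← lp.single_smul]; simp

theorem addPhoton_ne_of_eq_zero {i : Fin M} {n : Fin M → ℕ} (h : n i = 0) (m : Fin M → ℕ) :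
    addPhoton i m ≠ n := by
  intro h1
  have := congrFun h1 i
  rw [addPhoton_apply_self] at this
  omega

theorem eq_zero_of_notMem_range_addPhoton {i : Fin M} {n : Fin M → ℕ}
    (h : n ∉ Set.range (addPhoton i)) : n i = 0 := by
  by_contra h0
  exact h ⟨removePhoton i n, addPhoton_removePhoton i n h0⟩

theorem annihilation_ketE_addPhoton (i : Fin M) (n : Fin M → ℕ) :
    annihilation i (ketE (addPhoton i n)) = (Real.sqrt ((n i : ℝ) + 1) : ℂ) • ket n := by
  ext m
  rw [annihilation_apply, lp.coeFn_smul, Pi.smul_apply, smul_eq_mul]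
  simp only [ketE, ket_apply, (addPhoton_injective i).eq_iff]
  split_ifs with h
  · rw [h]
  · simp

theorem annihilation_ketE_of_eq_zero {i : Fin M} {n : Fin M → ℕ} (h : n i = 0) :
    annihilation i (ketE n) = 0 := by
  ext m
  rw [annihilation_apply]
  simp [ketE, ket_apply, addPhoton_ne_of_eq_zero h m]

theorem creation_ketE (i : Fin M) (n : Fin M → ℕ) :
    creation i (ketE n) = (Real.sqrt ((n i : ℝ) + 1) : ℂ) • ket (addPhoton i n) := by
  ext m
  rw [creation_apply, lp.coeFn_smul, Pi.smul_apply, smul_eq_mul]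
  by_cases hm : m i = 0
  · simp [ket_apply, hm, (addPhoton_ne_of_eq_zero hm n).symm]
  · obtain ⟨k, rfl⟩ : ∃ k, addPhoton i k = m := ⟨_, addPhoton_removePhoton i m hm⟩
    simp only [ketE, ket_apply, removePhoton_addPhoton, (addPhoton_injective i).eq_iff]
    split_ifs with h
    · subst h; simp [addPhoton_apply_self]
    · simp

/-- Termwise expansion stands in for continuity, which the unbounded ladder operators lack. Up to a
shift of the index it is the expansion of `aᵢ ψ` itself in number states. -/
theorem hasSum_annihilation (i : Fin M) (ψ : finiteEnergy M) :
    HasSum (fun n => (ψ : Fock M) n • annihilation i (ketE n)) (annihilation i ψ) := by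
  rw [← (addPhoton_injective i).hasSum_iff]
  · convert hasSum_ket (annihilation i ψ) using 2 with n
    simp only [Function.comp_apply]
    rw [annihilation_apply, annihilation_ketE_addPhoton, smul_smul, mul_comm]
  · intro n hn
    rw [annihilation_ketE_of_eq_zero (eq_zero_of_notMem_range_addPhoton hn), smul_zero]

theorem hasSum_creation (i : Fin M) (ψ : finiteEnergy M) :
    HasSum (fun n => (ψ : Fock M) n • creation i (ketE n)) (creation i ψ) := by
  have h := hasSum_ket (creation i ψ)
  rw [← (addPhoton_injective i).hasSum_iff] at h
  · convert h using 2 with n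
    simp only [Function.comp_apply]
    rw [creation_apply, creation_ketE, smul_smul, removePhoton_addPhoton, addPhoton_apply_self,
      mul_comm]
    push_cast
    rfl
  · intro n hn
    rw [creation_apply, eq_zero_of_notMem_range_addPhoton hn]
    simp

/-- `aᵢ†` is the adjoint of `aᵢ`. -/
theorem inner_creation_left (i : Fin M) (χ ψ : finiteEnergy M) :
    inner ℂ (creation i χ) (ψ : Fock M) = inner ℂ (χ : Fock M) (annihilation i ψ) := by
  have h1 := lp.hasSum_inner (𝕜 := ℂ) (G := fun _ : Fin M → ℕ => ℂ) (creation i χ) (ψ : Fock M)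
  rw [← (addPhoton_injective i).hasSum_iff] at h1
  · refine h1.unique ?_
    convert lp.hasSum_inner (𝕜 := ℂ) (G := fun _ : Fin M → ℕ => ℂ) (χ : Fock M) (annihilation i ψ) using 2 with n
    simp only [Function.comp_apply, annihilation_apply, creation_apply, removePhoton_addPhoton,
      addPhoton_apply_self, RCLike.inner_apply, map_mul, Complex.conj_ofReal]
    push_cast
    ring
  · intro n hn
    rw [creation_apply, eq_zero_of_notMem_range_addPhoton hn]
    simp

theorem inner_creation_right (i : Fin M) (χ ψ : finiteEnergy M) :
    inner ℂ (χ : Fock M) (creation i ψ) = inner ℂ (annihilation i χ) (ψ : Fock M) := by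
  rw [← inner_conj_symm, inner_creation_left, inner_conj_symm]

/-! ### Linear forms in the ladder operators and their intertwiners -/

/-- The operator `∑ⱼ (cⱼ aⱼ + dⱼ aⱼ†)`. -/
def linearForm (c d : Fin M → ℂ) : finiteEnergy M →ₗ[ℂ] Fock M :=
  ∑ j, (c j • annihilation j + d j • creation j)

theorem linearForm_apply (c d : Fin M → ℂ) (ψ : finiteEnergy M) :
    linearForm c d ψ = ∑ j, (c j • annihilation j ψ + d j • creation j ψ) := by
  simp [linearForm]

theorem hasSum_linearForm (c d : Fin M → ℂ) (ψ : finiteEnergy M) :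
    HasSum (fun n => (ψ : Fock M) n • linearForm c d (ketE n)) (linearForm c d ψ) := by
  simp only [linearForm_apply, Finset.smul_sum, smul_add]
  refine hasSum_sum fun j _ => HasSum.add ?_ ?_
  · simpa only [smul_comm (c j)] using (hasSum_annihilation j ψ).const_smul (c j)
  · simpa only [smul_comm (d j)] using (hasSum_creation j ψ).const_smul (d j)

theorem linearForm_single_left (i : Fin M) (ψ : finiteEnergy M) :
    linearForm (Pi.single i 1) 0 ψ = annihilation i ψ := by
  simp [linearForm_apply, Pi.single_apply]

theorem linearForm_single_right (i : Fin M) (ψ : finiteEnergy M) :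
    linearForm 0 (Pi.single i 1) ψ = creation i ψ := by
  simp [linearForm_apply, Pi.single_apply]

/-- Continuous maps that intertwine a linear form on the number states do so on all states of
finite energy. -/
theorem clm_eq_of_ket {E : Type*} [NormedAddCommGroup E] [NormedSpace ℂ E]
    (F₁ F₂ : Fock M →L[ℂ] E) (c d : Fin M → ℂ)
    (h : ∀ n, F₁ (ket n) = F₂ (linearForm c d (ketE n))) (ψ : finiteEnergy M) :
    F₁ ψ = F₂ (linearForm c d ψ) := by
  refine ((hasSum_ket (ψ : Fock M)).mapL F₁).unique ?_
  convert (hasSum_linearForm c d ψ).mapL F₂ using 2 with n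
  rw [map_smul, map_smul, h]

/-- `G` maps states of finite energy to states of finite energy, and
`aᵢ G = G ∑ⱼ (Aᵢⱼ aⱼ + Bᵢⱼ aⱼ†)`, `aᵢ† G = G ∑ⱼ (B̄ᵢⱼ aⱼ + Āᵢⱼ aⱼ†)`. -/
structure Intertwines (G : Fock M →L[ℂ] Fock M) (A B : Matrix (Fin M) (Fin M) ℂ) : Prop where
  mem : ∀ ψ ∈ finiteEnergy M, G ψ ∈ finiteEnergy M
  annih : ∀ i (ψ : finiteEnergy M),
    annihilation i ⟨G ψ, mem ψ ψ.2⟩ = G (linearForm (A i) (B i) ψ)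
  creat : ∀ i (ψ : finiteEnergy M),
    creation i ⟨G ψ, mem ψ ψ.2⟩ = G (linearForm (star (B i)) (star (A i)) ψ)

/-- Each amplitude of `aᵢ G ψ` is a bounded functional of `G ψ`, so the relations extend amplitude
by amplitude from number states. As the right-hand side is a Fock state, finite energy of `G ψ` then
follows. -/
theorem Intertwines.of_ket (G : Fock M →L[ℂ] Fock M) (A B : Matrix (Fin M) (Fin M) ℂ)
    (mem : ∀ n, G (ket n) ∈ finiteEnergy M)
    (ha : ∀ i n, annihilation i ⟨G (ket n), mem n⟩ = G (linearForm (A i) (B i) (ketE n)))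
    (hc : ∀ i n, creation i ⟨G (ket n), mem n⟩ =
      G (linearForm (star (B i)) (star (A i)) (ketE n))) : Intertwines G A B := by
  have h1 : ∀ i (ψ : finiteEnergy M) (m : Fin M → ℕ),
      (Real.sqrt ((m i : ℝ) + 1) : ℂ) * G ψ (addPhoton i m) = G (linearForm (A i) (B i) ψ) m := by
    intro i ψ m
    have := clm_eq_of_ket ((Real.sqrt ((m i : ℝ) + 1) : ℂ) • (innerSL ℂ (ket (addPhoton i m))).comp G)
      ((innerSL ℂ (ket m)).comp G) (A i) (B i) ?_ ψ
    · simpa [inner_ket] using this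
    · intro n
      have := congrArg (fun f : Fock M => f m) (ha i n)
      simpa [inner_ket, annihilation_apply] using this
  have h2 : ∀ i (ψ : finiteEnergy M) (m : Fin M → ℕ),
      (Real.sqrt (m i : ℝ) : ℂ) * G ψ (removePhoton i m) =
        G (linearForm (star (B i)) (star (A i)) ψ) m := by
    intro i ψ m
    have := clm_eq_of_ket ((Real.sqrt (m i : ℝ) : ℂ) • (innerSL ℂ (ket (removePhoton i m))).comp G)
      ((innerSL ℂ (ket m)).comp G) (star (B i)) (star (A i)) ?_ ψ
    · simpa [inner_ket] using this
    · intro n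
      have := congrArg (fun f : Fock M => f m) (hc i n)
      simpa [inner_ket, creation_apply] using this
  refine ⟨fun ψ hψ => mem_finiteEnergy_of_annihilation _ fun i m => h1 i ⟨ψ, hψ⟩ m,
    fun i ψ => ?_, fun i ψ => ?_⟩
  · ext m; rw [annihilation_apply]; exact h1 i ψ m
  · ext m; rw [creation_apply]; exact h2 i ψ m

/-! ### Commutation relations and the adjoint relation for creation operators -/

/-- The formal commutation relation `aᵢ aⱼ† = aⱼ† aᵢ + δᵢⱼ` on amplitudes. -/
theorem amplitude_commutator (i j : Fin M) (f : (Fin M → ℕ) → ℂ) (m : Fin M → ℕ) :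
    (Real.sqrt ((m i : ℝ) + 1) : ℂ) *
        ((Real.sqrt (addPhoton i m j : ℝ) : ℂ) * f (removePhoton j (addPhoton i m))) =
      (Real.sqrt (m j : ℝ) : ℂ) * ((Real.sqrt ((removePhoton j m i : ℝ) + 1) : ℂ) *
        f (addPhoton i (removePhoton j m))) + (if i = j then 1 else 0) * f m := by
  by_cases hij : i = j
  · subst hij
    rw [removePhoton_addPhoton, addPhoton_apply_self, if_pos rfl]
    have h1 : ((Real.sqrt ((m i : ℝ) + 1) : ℝ) : ℂ) * (Real.sqrt ((m i : ℝ) + 1) : ℝ) =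
        (m i : ℂ) + 1 := by
      rw [← Complex.ofReal_mul, Real.mul_self_sqrt (by positivity)]; push_cast; rfl
    have h2 : ((Real.sqrt (m i : ℝ) : ℝ) : ℂ) * (Real.sqrt (m i : ℝ) : ℝ) = (m i : ℂ) := by
      rw [← Complex.ofReal_mul, Real.mul_self_sqrt (by positivity)]; push_cast; rfl
    by_cases hm : m i = 0
    · simp [hm]
    · have h3 : (removePhoton i m i : ℝ) + 1 = m i := by
        have : removePhoton i m i + 1 = m i := by simp [removePhoton]; omega
        exact_mod_cast this
      rw [addPhoton_removePhoton i m hm, h3]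
      push_cast
      linear_combination (f m) * h1 - (f m) * h2
  · have hji : j ≠ i := Ne.symm hij
    have h1 : addPhoton i m j = m j := by simp [addPhoton, hji]
    have h2 : removePhoton j m i = m i := by simp [removePhoton, hij]
    have h3 : removePhoton j (addPhoton i m) = addPhoton i (removePhoton j m) := by
      simp [removePhoton, addPhoton, hij, hji, Function.update_comm hij]
    rw [h1, h2, h3, if_neg hij]
    ring

theorem addPhoton_comm (i j : Fin M) (m : Fin M → ℕ) :
    addPhoton i (addPhoton j m) = addPhoton j (addPhoton i m) := by
  by_cases hij : i = j
  · rw [hij]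
  · simp [addPhoton, hij, Ne.symm hij, Function.update_comm hij]

/-- The formal commutation relation `aᵢ aⱼ = aⱼ aᵢ` on amplitudes. -/
theorem amplitude_comm (i j : Fin M) (f : (Fin M → ℕ) → ℂ) (m : Fin M → ℕ) :
    (Real.sqrt ((m i : ℝ) + 1) : ℂ) *
        ((Real.sqrt ((addPhoton i m j : ℝ) + 1) : ℂ) * f (addPhoton j (addPhoton i m))) =
      (Real.sqrt ((m j : ℝ) + 1) : ℂ) * ((Real.sqrt ((addPhoton j m i : ℝ) + 1) : ℂ) *
        f (addPhoton i (addPhoton j m))) := by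
  by_cases hij : i = j
  · rw [hij]
  · have h1 : addPhoton i m j = m j := by simp [addPhoton, Ne.symm hij]
    have h2 : addPhoton j m i = m i := by simp [addPhoton, hij]
    rw [h1, h2, addPhoton_comm]
    ring

theorem inner_annihilation_ketE (i : Fin M) (n : Fin M → ℕ) (φ : Fock M) :
    inner ℂ (annihilation i (ketE n)) φ = (Real.sqrt (n i : ℝ) : ℂ) * φ (removePhoton i n) := by
  by_cases hn : n i = 0
  · rw [annihilation_ketE_of_eq_zero hn, inner_zero_left, hn]; simp
  · obtain ⟨k, rfl⟩ : ∃ k, addPhoton i k = n := ⟨_, addPhoton_removePhoton i n hn⟩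
    rw [annihilation_ketE_addPhoton, inner_smul_left, inner_ket, removePhoton_addPhoton,
      addPhoton_apply_self, Complex.conj_ofReal]
    push_cast
    rfl

theorem inner_creation_ketE (i : Fin M) (n : Fin M → ℕ) (φ : Fock M) :
    inner ℂ (creation i (ketE n)) φ = (Real.sqrt ((n i : ℝ) + 1) : ℂ) * φ (addPhoton i n) := by
  rw [creation_ketE, inner_smul_left, inner_ket, Complex.conj_ofReal]

theorem hasSum_inner_left {ψ : Fock M} {F : (Fin M → ℕ) → Fock M} {χ : Fock M}
    (h : HasSum (fun n => ψ n • F n) χ) (φ : Fock M) :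
    HasSum (fun n => starRingEnd ℂ (ψ n) * inner ℂ (F n) φ) (inner ℂ χ φ) := by
  have h1 := (h.mapL (innerSL ℂ φ)).star
  simpa [← inner_smul_left] using h1

/-- The canonical commutation relation `aⱼ aᵢ† - aᵢ† aⱼ = δᵢⱼ` as an identity of forms. -/
theorem inner_creation_creation (i j : Fin M) (χ ψ : finiteEnergy M) :
    inner ℂ (creation i χ) (creation j ψ) = inner ℂ (annihilation j χ) (annihilation i ψ) +
      (if i = j then 1 else 0) * inner ℂ (χ : Fock M) (ψ : Fock M) := by
  refine (hasSum_inner_left (hasSum_creation i χ) _).unique ?_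
  convert (hasSum_inner_left (hasSum_annihilation j χ) (annihilation i ψ)).add
    ((hasSum_inner_left (hasSum_ket (χ : Fock M)) (ψ : Fock M)).mul_left (if i = j then 1 else 0))
    using 2 with n
  rw [inner_creation_ketE, inner_annihilation_ketE, inner_ket, creation_apply, annihilation_apply,
    amplitude_commutator]
  ring

/-- The weak form of `aᵢ aⱼ = aⱼ aᵢ`: a product of two ladder operators need not be defined on a
state of finite energy, so one factor stands on the left. -/
theorem inner_creation_annihilation (i j : Fin M) (χ ψ : finiteEnergy M) :
    inner ℂ (creation i χ) (annihilation j ψ) = inner ℂ (creation j χ) (annihilation i ψ) := by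
  refine (hasSum_inner_left (hasSum_creation i χ) _).unique ?_
  convert hasSum_inner_left (hasSum_creation j χ) (annihilation i ψ) using 2 with n
  rw [inner_creation_ketE, inner_creation_ketE, annihilation_apply, annihilation_apply,
    amplitude_comm]

theorem inner_linearForm_left (c d : Fin M → ℂ) (χ ψ : finiteEnergy M) :
    inner ℂ (linearForm c d χ) (ψ : Fock M) =
      inner ℂ (χ : Fock M) (linearForm (star d) (star c) ψ) := by
  simp only [linearForm_apply, sum_inner, inner_sum, inner_add_left, inner_add_right,
    inner_smul_left, inner_smul_right, inner_creation_left, inner_creation_right]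
  refine Finset.sum_congr rfl fun j _ => ?_
  simp [add_comm]

/-- The entrywise complex conjugate of a matrix. -/
abbrev entryConj (A : Matrix (Fin M) (Fin M) ℂ) : Matrix (Fin M) (Fin M) ℂ :=
  A.map (starRingEnd ℂ)

theorem linearForm_combination (c d : Fin M → ℂ) (A B : Matrix (Fin M) (Fin M) ℂ)
    (ψ : finiteEnergy M) :
    ∑ j, (c j • linearForm (A j) (B j) ψ + d j • linearForm (star (B j)) (star (A j)) ψ) =
      linearForm (c ᵥ* A + d ᵥ* entryConj B) (c ᵥ* B + d ᵥ* entryConj A) ψ := by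
  simp only [linearForm_apply, Finset.smul_sum, ← Finset.sum_add_distrib]
  rw [Finset.sum_comm]
  refine Finset.sum_congr rfl fun k _ => ?_
  simp only [Matrix.vecMul, dotProduct, Pi.add_apply, add_smul, Finset.sum_smul, smul_add,
    Finset.sum_add_distrib, mul_smul, Pi.star_apply, Matrix.map_apply, starRingEnd_apply]
  abel

theorem Intertwines.linearForm_map {G : Fock M →L[ℂ] Fock M} {A B : Matrix (Fin M) (Fin M) ℂ}
    (h : Intertwines G A B) (c d : Fin M → ℂ) (ψ : finiteEnergy M) :
    linearForm c d ⟨G ψ, h.mem ψ ψ.2⟩ =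
      G (linearForm (c ᵥ* A + d ᵥ* entryConj B) (c ᵥ* B + d ᵥ* entryConj A) ψ) := by
  rw [← linearForm_combination, linearForm_apply, map_sum]
  refine Finset.sum_congr rfl fun j _ => ?_
  rw [h.annih, h.creat, map_add, map_smul, map_smul]

/-- The unitary `G` as a continuous linear map. -/
abbrev toCLM (G : Fock M ≃ₗᵢ[ℂ] Fock M) : Fock M →L[ℂ] Fock M :=
  G.toLinearIsometry.toContinuousLinearMap

/-- The creation relation is the adjoint of the annihilation relation, tested on `|n⟩ = G (G⁻¹
|n⟩)`. This is where `G⁻¹` must preserve the domain too. -/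
theorem HasBogoliubov.intertwines {G : Fock M ≃ₗᵢ[ℂ] Fock M} {A B : Matrix (Fin M) (Fin M) ℂ}
    (h : HasBogoliubov G A B) : Intertwines (toCLM G) A B where
  mem ψ hψ := (h.mem_iff ψ).2 hψ
  annih i ψ := by
    rw [linearForm_apply]; exact h.conj i ψ
  creat i ψ := by
    ext n
    rw [← inner_ket, ← inner_ket]
    have hχ : G.symm (ket n) ∈ finiteEnergy M := by
      rw [← h.mem_iff, G.apply_symm_apply]; exact ket_mem n
    have h1 : (ketE n : finiteEnergy M) = ⟨G (G.symm (ket n)), (h.mem_iff _).2 hχ⟩ := by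
      ext1; simp [ketE]
    have h2 := h.conj i ⟨G.symm (ket n), hχ⟩
    rw [← h1] at h2
    have h3 := inner_creation_right i (ketE n) ⟨G ψ, (h.mem_iff ψ).2 ψ.2⟩
    rw [h2, LinearIsometryEquiv.inner_map_map, ← linearForm_apply, inner_linearForm_left,
      ← G.inner_map_map (G.symm (ket n)), G.apply_symm_apply] at h3
    exact h3

theorem Intertwines.hasBogoliubov {G : Fock M ≃ₗᵢ[ℂ] Fock M} {A B : Matrix (Fin M) (Fin M) ℂ}
    (h : Intertwines (toCLM G) A B) (hG : ∀ ψ ∈ finiteEnergy M, G.symm ψ ∈ finiteEnergy M) :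
    HasBogoliubov G A B where
  mem_iff ψ := ⟨fun h1 => by simpa using hG _ h1, h.mem ψ⟩
  conj i ψ := by
    rw [← linearForm_apply]; exact h.annih i ψ

/-! ### Algebra of Bogoliubov matrices; the phase shifter -/

/-- The matrix identities that express the canonical commutation relations of
`∑ⱼ (Aᵢⱼ aⱼ + Bᵢⱼ aⱼ†)` and their adjoints. -/
structure IsBogoliubovPair (A B : Matrix (Fin M) (Fin M) ℂ) : Prop where
  comm_adjoint : A * Aᴴ - B * Bᴴ = 1
  comm : A * Bᵀ = B * Aᵀ

theorem annihilation_vacuum (i : Fin M) : annihilation i (ketE 0) = 0 :=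
  annihilation_ketE_of_eq_zero rfl

theorem inner_creation_vacuum (i j : Fin M) :
    inner ℂ (creation i (ketE 0)) (creation j (ketE 0)) = if i = j then (1 : ℂ) else 0 := by
  rw [inner_creation_creation, annihilation_vacuum, inner_zero_left, zero_add]
  have : inner ℂ ((ketE 0 : finiteEnergy M) : Fock M) ((ketE 0 : finiteEnergy M) : Fock M) =
    (1 : ℂ) := (inner_ket _ _).trans (ket_apply_self _)
  rw [this, mul_one]

theorem inner_linearForm_vacuum (c d c' d' : Fin M → ℂ) :
    inner ℂ (linearForm c d (ketE 0)) (linearForm c' d' (ketE 0)) = star d ⬝ᵥ d' := by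
  simp only [linearForm_apply, annihilation_vacuum, smul_zero, zero_add, sum_inner, inner_sum,
    inner_smul_left, inner_smul_right, inner_creation_vacuum]
  simp [dotProduct, mul_comm]

/-- The commutation relations are evaluated in the state `G |0⟩`. Once moved through the isometry
`G`, the linear forms act on the vacuum, and their inner products there are products of rows of `A`
and `B`. -/
theorem HasBogoliubov.isBogoliubovPair {G : Fock M ≃ₗᵢ[ℂ] Fock M}
    {A B : Matrix (Fin M) (Fin M) ℂ} (h : HasBogoliubov G A B) : IsBogoliubovPair A B := by
  have hI := h.intertwines
  constructor
  · ext i j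
    have h1 := inner_creation_creation i j ⟨_, hI.mem _ (ketE 0).2⟩ ⟨_, hI.mem _ (ketE 0).2⟩
    rw [hI.creat, hI.creat, hI.annih, hI.annih] at h1
    simp only [LinearIsometry.coe_toContinuousLinearMap, LinearIsometry.inner_map_map,
      inner_linearForm_vacuum] at h1
    have h2 : inner ℂ ((ketE 0 : finiteEnergy M) : Fock M) ((ketE 0 : finiteEnergy M) : Fock M) =
      (1 : ℂ) := (inner_ket _ _).trans (ket_apply_self _)
    rw [h2, star_star, mul_one] at h1
    rw [Matrix.sub_apply, Matrix.mul_apply, Matrix.mul_apply, Matrix.one_apply]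
    simp only [dotProduct, Pi.star_apply] at h1
    simp only [Matrix.conjTranspose_apply]
    rw [h1, add_sub_assoc, add_comm, sub_eq_neg_add, add_assoc]
    simp [mul_comm]
  · ext i j
    have h1 := inner_creation_annihilation i j ⟨_, hI.mem _ (ketE 0).2⟩ ⟨_, hI.mem _ (ketE 0).2⟩
    rw [hI.creat, hI.creat, hI.annih, hI.annih] at h1
    simp only [LinearIsometry.coe_toContinuousLinearMap, LinearIsometry.inner_map_map,
      inner_linearForm_vacuum, star_star] at h1
    rw [Matrix.mul_apply, Matrix.mul_apply]
    simp only [Matrix.transpose_apply]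
    simp only [dotProduct] at h1
    rw [h1]
    simp [mul_comm]

theorem IsBogoliubovPair.entryConj_mul {A B : Matrix (Fin M) (Fin M) ℂ}
    (h : IsBogoliubovPair A B) :
    entryConj A * Aᵀ - entryConj B * Bᵀ = 1 ∧ entryConj A * Bᴴ = entryConj B * Aᴴ := by
  constructor
  · have := congrArg (fun X => Matrix.map X (starRingEnd ℂ)) h.comm_adjoint
    simp only [Matrix.map_sub _ (map_sub (starRingEnd ℂ)), Matrix.map_mul] at this
    convert this using 1
    · congr 2 <;> ext <;> simp
    · simp
  · have := congrArg (fun X => Matrix.map X (starRingEnd ℂ)) h.comm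
    simp only [Matrix.map_mul] at this
    exact this

/-- The relations of the pair and their conjugates exhibit a right inverse of the block matrix. For
square matrices it is also a left inverse, and the first block row of the reversed product gives
both identities. -/
theorem IsBogoliubovPair.inverse_mul {A B : Matrix (Fin M) (Fin M) ℂ} (h : IsBogoliubovPair A B) :
    Aᴴ * A - Bᵀ * entryConj B = 1 ∧ Aᴴ * B = Bᵀ * entryConj A := by
  have h1 := h.comm_adjoint
  have h2 := h.comm
  obtain ⟨h3, h4⟩ := h.entryConj_mul
  have h5 : Matrix.fromBlocks A B (entryConj B) (entryConj A) *
      Matrix.fromBlocks Aᴴ (-Bᵀ) (-Bᴴ) Aᵀ = 1 := by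
    rw [Matrix.fromBlocks_multiply, ← Matrix.fromBlocks_one]
    congr 1
    · rw [← h1]; simp [sub_eq_add_neg]
    · simp [h2]
    · simp [h4]
    · rw [← h3]; simp [sub_eq_neg_add]
  rw [mul_eq_one_comm, Matrix.fromBlocks_multiply, ← Matrix.fromBlocks_one,
    Matrix.fromBlocks_inj] at h5
  obtain ⟨h6, h7, -, -⟩ := h5
  refine ⟨by rw [← h6]; simp [sub_eq_add_neg], ?_⟩
  rw [← sub_eq_zero, ← h7]; simp [sub_eq_add_neg]

theorem IsBogoliubovPair.inv {A B : Matrix (Fin M) (Fin M) ℂ} (h : IsBogoliubovPair A B) :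
    IsBogoliubovPair Aᴴ (-Bᵀ) := by
  obtain ⟨h1, h2⟩ := h.inverse_mul
  refine ⟨?_, ?_⟩
  · rw [← h1]; simp; rfl
  · have : Bᵀ * entryConj A = Bᵀ * Aᴴᵀ := by rfl
    simp [h2, ← this]

theorem HasBogoliubov.mul {G H : Fock M ≃ₗᵢ[ℂ] Fock M} {A B A' B' : Matrix (Fin M) (Fin M) ℂ}
    (hG : HasBogoliubov G A B) (hH : HasBogoliubov H A' B') :
    HasBogoliubov (G * H) (A * A' + B * entryConj B') (A * B' + B * entryConj A') where
  mem_iff ψ := (hG.mem_iff _).trans (hH.mem_iff ψ)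
  conj i ψ := by
    have h1 := hG.intertwines.annih i ⟨H ψ, (hH.mem_iff _).2 ψ.2⟩
    have h2 := hH.intertwines.linearForm_map (A i) (B i) ψ
    rw [← linearForm_apply]
    exact h1.trans (congrArg G h2)

theorem HasBogoliubov.inv {G : Fock M ≃ₗᵢ[ℂ] Fock M} {A B : Matrix (Fin M) (Fin M) ℂ}
    (hG : HasBogoliubov G A B) : HasBogoliubov G⁻¹ Aᴴ (-Bᵀ) where
  mem_iff ψ := by
    rw [← hG.mem_iff]
    exact iff_of_eq (congrArg (· ∈ finiteEnergy M) (G.apply_symm_apply ψ))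
  conj i ψ := by
    have hχ : G.symm ψ ∈ finiteEnergy M := by
      rw [← hG.mem_iff, G.apply_symm_apply]; exact ψ.2
    obtain ⟨h1, h2⟩ := hG.isBogoliubovPair.inverse_mul
    have h3 := hG.intertwines.linearForm_map (Aᴴ i) ((-Bᵀ) i) ⟨G.symm ψ, hχ⟩
    rw [sub_eq_add_neg, ← neg_mul] at h1
    rw [← sub_eq_zero, sub_eq_add_neg, ← neg_mul] at h2
    have h4 : Aᴴ i ᵥ* A + (-Bᵀ) i ᵥ* entryConj B = Pi.single i 1 :=
      (congrFun h1 i).trans (funext fun _ => Matrix.one_eq_pi_single)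
    have h5 : Aᴴ i ᵥ* B + (-Bᵀ) i ᵥ* entryConj A = 0 := congrFun h2 i
    rw [h4, h5, linearForm_single_left] at h3
    have h6 : (⟨toCLM G (G.symm ψ), hG.intertwines.mem _ hχ⟩ : finiteEnergy M) = ψ := by
      ext1; exact G.apply_symm_apply _
    rw [h6] at h3
    rw [← linearForm_apply, h3]
    exact (G.symm_apply_apply _).symm

theorem phase_addPhoton (φ : Fin M → ℝ) (i : Fin M) (n : Fin M → ℕ) :
    phase φ (addPhoton i n) = Complex.exp (φ i * Complex.I) * phase φ n := by
  rw [phase, phase, ← Complex.exp_add]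
  congr 1
  have : (∑ j, φ j * (addPhoton i n j : ℝ)) = φ i + ∑ j, φ j * (n j : ℝ) := by
    have h1 : ∀ j, φ j * (addPhoton i n j : ℝ) = (if j = i then φ i else 0) + φ j * (n j : ℝ) := by
      intro j
      by_cases h : j = i
      · subst h; rw [addPhoton_apply_self]; simp; ring
      · simp [addPhoton, h]
    simp [h1, Finset.sum_add_distrib]
  rw [this]; push_cast; ring

theorem phaseShifter_hasBogoliubov (φ : Fin M → ℝ) :
    HasBogoliubov (phaseShifter φ)
      (Matrix.diagonal fun i => Complex.exp (φ i * Complex.I)) 0 where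
  mem_iff ψ := by
    change Memℓp _ 2 ↔ Memℓp _ 2
    rw [memℓp_two_iff, memℓp_two_iff]
    refine iff_of_eq (congrArg Summable (funext fun n => ?_))
    simp [sqrtNumber, phaseShifter, norm_phase]
  conj i ψ := by
    ext n
    rw [annihilation_apply]
    simp [Matrix.diagonal_apply, phaseShifter, annihilation_apply, phase_addPhoton]
    ring

/-! ### Takagi factorization and the Bloch-Messiah decomposition of matrices -/

/-- The square of `J` is complex linear, and symmetry gives `⟨J w, J w⟩ = ⟨J (J w), w⟩`, so an
eigenvalue is `σ²` with `σ = ‖J w‖ / ‖w‖`. Then `J w + σ w` is a coneigenvector unless it vanishes,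
in which case antilinearity turns the sign around for `i w`. -/
theorem exists_coneigenvector {E : Type*} [NormedAddCommGroup E] [InnerProductSpace ℂ E]
    [FiniteDimensional ℂ E] [Nontrivial E] (J : E →ₛₗ[starRingEnd ℂ] E)
    (hJ : ∀ u v, inner ℂ (J u) v = inner ℂ (J v) u) :
    ∃ (v : E) (σ : ℝ), ‖v‖ = 1 ∧ J v = (σ : ℂ) • v := by
  suffices h : ∃ (v : E) (σ : ℝ), v ≠ 0 ∧ J v = (σ : ℂ) • v by
    obtain ⟨v, σ, hv, h⟩ := h
    refine ⟨((‖v‖⁻¹ : ℝ) : ℂ) • v, σ, ?_, ?_⟩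
    · rw [norm_smul, Complex.norm_real, norm_inv, norm_norm, inv_mul_cancel₀ (norm_ne_zero_iff.2 hv)]
    · rw [LinearMap.map_smulₛₗ, h, Complex.conj_ofReal, smul_comm]
  obtain ⟨l, hl⟩ := Module.End.exists_eigenvalue (J.comp J : E →ₗ[ℂ] E)
  obtain ⟨w, hw⟩ := hl.exists_hasEigenvector
  have hJJ : J (J w) = l • w := hw.apply_eq_smul
  have hw0 : (‖w‖ : ℂ) ≠ 0 := by exact_mod_cast norm_ne_zero_iff.2 hw.2
  obtain ⟨σ, hσ⟩ : ∃ σ : ℝ, l = (σ : ℂ) * σ := by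
    refine ⟨‖J w‖ / ‖w‖, ?_⟩
    have h1 := hJ w (J w)
    rw [hJJ, inner_smul_left, inner_self_eq_norm_sq_to_K, inner_self_eq_norm_sq_to_K] at h1
    have h2 := congrArg (starRingEnd ℂ) h1
    simp only [map_mul, map_pow, Complex.conj_conj, Complex.coe_algebraMap] at h2
    simp at h2
    push_cast
    field_simp
    rw [h2]
  by_cases h0 : J w + (σ : ℂ) • w = 0
  · refine ⟨Complex.I • w, σ, smul_ne_zero Complex.I_ne_zero hw.2, ?_⟩
    rw [LinearMap.map_smulₛₗ, eq_neg_of_add_eq_zero_left h0, Complex.conj_I, neg_smul_neg, smul_comm]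
  · refine ⟨_, σ, h0, ?_⟩
    rw [map_add, LinearMap.map_smulₛₗ, hJJ, hσ, Complex.conj_ofReal, smul_add, smul_smul, add_comm]

/-- A symmetric antilinear map has an orthonormal basis of coneigenvectors. -/
theorem exists_orthonormal_coneigenvectors (n : ℕ) : ∀ {E : Type} [NormedAddCommGroup E]
    [InnerProductSpace ℂ E] [FiniteDimensional ℂ E] (J : E →ₛₗ[starRingEnd ℂ] E),
    (∀ u v, inner ℂ (J u) v = inner ℂ (J v) u) → Module.finrank ℂ E = n →
    ∃ (b : Fin n → E) (σ : Fin n → ℝ), Orthonormal ℂ b ∧ ∀ i, J (b i) = (σ i : ℂ) • b i := by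
  induction n with
  | zero =>
    intro E _ _ _ J _ _
    exact ⟨Fin.elim0, Fin.elim0, ⟨fun i => i.elim0, fun i => i.elim0⟩, fun i => i.elim0⟩
  | succ n ih =>
    intro E _ _ _ J hJ hE
    have : Nontrivial E := Module.nontrivial_of_finrank_pos (R := ℂ) (by omega)
    obtain ⟨v, s, hv, hJv⟩ := exists_coneigenvector J hJ
    have hv0 : v ≠ 0 := by rw [← norm_ne_zero_iff, hv]; exact one_ne_zero
    have hK : ∀ w : (ℂ ∙ v)ᗮ, J w ∈ (ℂ ∙ v)ᗮ := by
      intro w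
      rw [Submodule.mem_orthogonal_singleton_iff_inner_left, hJ, hJv, inner_smul_left,
        Submodule.mem_orthogonal_singleton_iff_inner_right.1 w.2, mul_zero]
    have : Fact (Module.finrank ℂ E = n + 1) := ⟨hE⟩
    obtain ⟨b, σ, hb, hJb⟩ := ih ((J.domRestrict (ℂ ∙ v)ᗮ).codRestrict (ℂ ∙ v)ᗮ hK)
      (fun u w => hJ u w) (Submodule.finrank_orthogonal_span_singleton hv0)
    refine ⟨Fin.cons v fun i => (b i : E), Fin.cons s σ, ?_, ?_⟩
    · rw [orthonormal_iff_ite] at hb ⊢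
      intro i j
      refine Fin.cases ?_ (fun i => ?_) i <;> refine Fin.cases ?_ (fun j => ?_) j
      · simp [inner_self_eq_norm_sq_to_K, hv]
      · simpa [(Fin.succ_ne_zero j).symm] using
          Submodule.mem_orthogonal_singleton_iff_inner_right.1 (b j).2
      · simpa [Fin.succ_ne_zero i] using
          Submodule.mem_orthogonal_singleton_iff_inner_left.1 (b i).2
      · simpa using hb i j
    · intro i
      refine Fin.cases ?_ (fun i => ?_) i
      · simpa using hJv
      · have h1 : J (b i) = (σ i : ℂ) • (b i : E) := congrArg Subtype.val (hJb i)
        simpa using h1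

/-- Takagi factorization of a complex symmetric matrix. -/
theorem exists_takagi (X : Matrix (Fin M) (Fin M) ℂ) (hX : Xᵀ = X) :
    ∃ U ∈ Matrix.unitaryGroup (Fin M) ℂ, ∃ τ : Fin M → ℝ,
      X = U * Matrix.diagonal (fun i => (τ i : ℂ)) * Uᵀ := by
  -- For `J v = X v̄`, symmetry of `X` is symmetry of `J`, and orthonormal coneigenvectors as
  -- columns of `U` give `X Ū = U τ`.
  let J : EuclideanSpace ℂ (Fin M) →ₛₗ[starRingEnd ℂ] EuclideanSpace ℂ (Fin M) :=
    { toFun := fun v => WithLp.toLp 2 (X *ᵥ star v.ofLp)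
      map_add' := fun u v => by simp [Matrix.mulVec_add]
      map_smul' := fun c v => by simp [Matrix.mulVec_smul] }
  have hJ : ∀ u v, inner ℂ (J u) v = inner ℂ (J v) u := by
    intro u v
    simp only [J, LinearMap.coe_mk, AddHom.coe_mk, PiLp.inner_apply, RCLike.inner_apply,
      Matrix.mulVec, dotProduct, map_sum, Finset.mul_sum]
    rw [Finset.sum_comm]
    refine Finset.sum_congr rfl fun i _ => Finset.sum_congr rfl fun j _ => ?_
    have : X j i = X i j := congrFun (congrFun hX i) j
    simp [this]
    ring
  obtain ⟨b, τ, hb, hJb⟩ := exists_orthonormal_coneigenvectors M J hJ (by simp)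
  let U : Matrix (Fin M) (Fin M) ℂ := Matrix.of fun i j => b j i
  have hU : Uᴴ * U = 1 := by
    ext i j
    rw [Matrix.mul_apply, Matrix.one_apply, ← orthonormal_iff_ite.1 hb i j, PiLp.inner_apply]
    refine Finset.sum_congr rfl fun k _ => ?_
    simp [U, mul_comm]
  have hXU : X * Uᴴᵀ = U * Matrix.diagonal (fun i => (τ i : ℂ)) := by
    ext i j
    have := congrArg (fun w : EuclideanSpace ℂ (Fin M) => w i) (hJb j)
    rw [Matrix.mul_diagonal, Matrix.mul_apply]
    simpa [J, U, Matrix.mulVec, dotProduct, mul_comm] using this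
  refine ⟨U, Matrix.mem_unitaryGroup_iff'.2 hU, τ, ?_⟩
  rw [← hXU, Matrix.mul_assoc, ← Matrix.transpose_mul, mul_eq_one_comm.1 hU]
  simp

open scoped ComplexOrder in
/-- The Bloch-Messiah decomposition of a pair of Bogoliubov matrices. -/
theorem IsBogoliubovPair.exists_blochMessiah {A B : Matrix (Fin M) (Fin M) ℂ}
    (h : IsBogoliubovPair A B) :
    ∃ U ∈ Matrix.unitaryGroup (Fin M) ℂ, ∃ V ∈ Matrix.unitaryGroup (Fin M) ℂ, ∃ r : Fin M → ℝ,
      A = U * Matrix.diagonal (fun i => (Real.cosh (r i) : ℂ)) * V ∧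
      B = U * Matrix.diagonal (fun i => (Real.sinh (r i) : ℂ)) * entryConj V := by
  have hA : IsUnit A.det := by
    have h1 : (A * Aᴴ).PosDef := by
      rw [sub_eq_iff_eq_add.1 h.comm_adjoint]
      exact Matrix.PosDef.one.add_posSemidef (Matrix.posSemidef_self_mul_conjTranspose B)
    have h2 := (Matrix.isUnit_iff_isUnit_det _).1 h1.isUnit
    rw [Matrix.det_mul] at h2
    exact isUnit_of_mul_isUnit_left h2
  have hX : (A⁻¹ * B)ᵀ = A⁻¹ * B := by
    have hA' : IsUnit Aᵀ.det := by rwa [Matrix.det_transpose]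
    rw [Matrix.transpose_mul, Matrix.transpose_nonsing_inv]
    calc Bᵀ * Aᵀ⁻¹ = A⁻¹ * (A * Bᵀ) * Aᵀ⁻¹ := by rw [Matrix.nonsing_inv_mul_cancel_left _ _ hA]
      _ = A⁻¹ * B := by
        rw [h.comm, ← Matrix.mul_assoc, Matrix.mul_nonsing_inv_cancel_right _ _ hA']
  obtain ⟨W, hW, τ, hτ⟩ := exists_takagi _ hX
  have hW1 : Wᴴ * W = 1 := Matrix.mem_unitaryGroup_iff'.1 hW
  have hW2 : W * Wᴴ = 1 := Matrix.mem_unitaryGroup_iff.1 hW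
  have hB : B = A * W * Matrix.diagonal (fun i => (τ i : ℂ)) * Wᵀ := by
    rw [Matrix.mul_assoc, Matrix.mul_assoc, ← Matrix.mul_assoc W, ← hτ,
      Matrix.mul_nonsing_inv_cancel_left _ _ hA]
  set N := A * W with hN
  have hAN : A = N * Wᴴ := by rw [hN, Matrix.mul_assoc, hW2, Matrix.mul_one]
  have hNN : N * Matrix.diagonal (fun i => (1 - τ i ^ 2 : ℂ)) * Nᴴ = 1 := by
    have h1 : A * Aᴴ = N * Nᴴ := by
      rw [hN, Matrix.conjTranspose_mul, Matrix.mul_assoc, ← Matrix.mul_assoc W, hW2, Matrix.one_mul]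
    have h2 : B * Bᴴ = N * Matrix.diagonal (fun i => (τ i ^ 2 : ℂ)) * Nᴴ := by
      have h3 : Wᵀ * Wᵀᴴ = 1 := by
        have := congrArg Matrix.transpose hW1
        rwa [Matrix.transpose_mul, Matrix.transpose_one] at this
      have h4 : (Matrix.diagonal (fun i => (τ i : ℂ)))ᴴ = Matrix.diagonal (fun i => (τ i : ℂ)) := by
        rw [Matrix.diagonal_conjTranspose]; congr 1; ext i; simp
      rw [hB, Matrix.conjTranspose_mul, Matrix.conjTranspose_mul, h4, Matrix.mul_assoc,
        ← Matrix.mul_assoc Wᵀ, h3, Matrix.one_mul, ← Matrix.mul_assoc, Matrix.mul_assoc N,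
        Matrix.diagonal_mul_diagonal]
      simp only [pow_two]
    rw [← h.comm_adjoint, h1, h2, ← Matrix.sub_mul, ← Matrix.diagonal_sub, Matrix.mul_sub]
    simp [Matrix.diagonal_one]
  -- Reversing the order in `hNN` gives `(1 - τ²) N† N = 1`, whose diagonal entries are `1 - τᵢ²`
  -- times a sum of squares.
  have hpos : ∀ i, 0 < 1 - τ i ^ 2 := by
    intro i
    have h1 := hNN
    rw [Matrix.mul_assoc, mul_eq_one_comm, Matrix.mul_assoc] at h1
    have h2 := congrFun (congrFun h1 i) i
    rw [Matrix.diagonal_mul, Matrix.one_apply_eq, Matrix.mul_apply] at h2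
    have h3 : ∑ j, Nᴴ i j * N j i = ((∑ j, Complex.normSq (N j i) : ℝ) : ℂ) := by
      push_cast
      refine Finset.sum_congr rfl fun j _ => ?_
      rw [Complex.normSq_eq_conj_mul_self]; rfl
    rw [h3] at h2
    have h4 : (1 - τ i ^ 2) * (∑ j, Complex.normSq (N j i)) = 1 := by exact_mod_cast h2
    have h5 : 0 ≤ ∑ j, Complex.normSq (N j i) := Finset.sum_nonneg fun j _ => Complex.normSq_nonneg _
    exact pos_of_mul_pos_left (by rw [h4]; exact one_pos) h5
  -- With `τ = tanh r` one has `q = 1 / cosh r`. By `hNN` the matrix `N q` is unitary; it is the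
  -- left factor of the decomposition.
  let q : Fin M → ℝ := fun i => Real.sqrt (1 - τ i ^ 2)
  have hq : ∀ i, 0 < q i := fun i => Real.sqrt_pos.2 (hpos i)
  have hqq : ∀ i, q i * q i = 1 - τ i ^ 2 := fun i => Real.mul_self_sqrt (hpos i).le
  let r : Fin M → ℝ := fun i => Real.arsinh (τ i / q i)
  have hsinh : ∀ i, q i * Real.sinh (r i) = τ i := by
    intro i
    rw [Real.sinh_arsinh, mul_div_cancel₀ _ (hq i).ne']
  have hcosh : ∀ i, q i * Real.cosh (r i) = 1 := by
    intro i
    have h1 : 1 + (τ i / q i) ^ 2 = (q i)⁻¹ ^ 2 := by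
      have := (hq i).ne'
      field_simp
      linarith [hqq i]
    rw [Real.cosh_arsinh, h1, Real.sqrt_sq (inv_pos.2 (hq i)).le, mul_inv_cancel₀ (hq i).ne']
  refine ⟨N * Matrix.diagonal fun i => (q i : ℂ), ?_, Wᴴ, ?_, r, ?_, ?_⟩
  · rw [Matrix.mem_unitaryGroup_iff, Matrix.star_eq_conjTranspose, Matrix.conjTranspose_mul,
      ← hNN, Matrix.diagonal_conjTranspose, ← Matrix.mul_assoc, Matrix.mul_assoc N,
      Matrix.diagonal_mul_diagonal]
    congr 3
    ext i
    have := hqq i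
    simp only [Pi.star_apply, Complex.star_def, Complex.conj_ofReal]
    exact_mod_cast this
  · exact Matrix.mem_unitaryGroup_iff.2 (by rw [Matrix.star_eq_conjTranspose,
      Matrix.conjTranspose_conjTranspose, hW1])
  · rw [Matrix.mul_assoc N, Matrix.diagonal_mul_diagonal]
    conv_lhs => rw [hAN]
    congr 1
    have : (fun i => (q i : ℂ) * (Real.cosh (r i) : ℂ)) = fun _ => 1 := by
      ext i; exact_mod_cast hcosh i
    rw [this, Matrix.diagonal_one, Matrix.mul_one]
  · rw [Matrix.mul_assoc N, Matrix.diagonal_mul_diagonal, hB]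
    have : (fun i => (q i : ℂ) * (Real.sinh (r i) : ℂ)) = fun i => (τ i : ℂ) := by
      ext i; exact_mod_cast hsinh i
    rw [this]
    congr 1
    ext i j
    simp

/-! ### States with geometrically decaying amplitudes -/

theorem sum_addPhoton (i : Fin M) (n : Fin M → ℕ) : ∑ j, addPhoton i n j = (∑ j, n j) + 1 := by
  rw [addPhoton, Finset.sum_update_of_mem (Finset.mem_univ i),
    ← Finset.add_sum_erase _ n (Finset.mem_univ i), Finset.erase_eq]
  omega

/-- A finite set of occupation numbers lies in a box, over which the sum factors into `M` truncated
geometric series. -/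
theorem summable_pow_sum {ρ : ℝ} (h0 : 0 ≤ ρ) (h1 : ρ < 1) :
    Summable fun n : Fin M → ℕ => ρ ^ (∑ i, n i) := by
  refine summable_of_sum_le (c := ((1 - ρ)⁻¹) ^ M) (fun n => by positivity) fun s => ?_
  obtain ⟨N, hN⟩ : ∃ N : ℕ, ∀ n ∈ s, ∀ i, n i < N := by
    refine ⟨(s.sup fun n => ∑ i, n i) + 1, fun n hn i => ?_⟩
    have h2 : n i ≤ ∑ j, n j := Finset.single_le_sum (fun _ _ => Nat.zero_le _) (Finset.mem_univ i)
    have h3 := Finset.le_sup (f := fun n : Fin M → ℕ => ∑ i, n i) hn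
    exact Nat.lt_succ_of_le (h2.trans h3)
  calc ∑ n ∈ s, ρ ^ (∑ i, n i)
      ≤ ∑ n ∈ Fintype.piFinset fun _ : Fin M => Finset.range N, ρ ^ (∑ i, n i) := by
        refine Finset.sum_le_sum_of_subset_of_nonneg (fun n hn => ?_) fun _ _ _ => by positivity
        simpa using hN n hn
    _ = ∏ _i : Fin M, ∑ k ∈ Finset.range N, ρ ^ k := by
        rw [Finset.prod_univ_sum]
        simp [Finset.prod_pow_eq_pow_sum]
    _ ≤ ((1 - ρ)⁻¹) ^ M := by
        rw [Finset.prod_const, Finset.card_univ, Fintype.card_fin]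
        refine pow_le_pow_left₀ (Finset.sum_nonneg fun _ _ => by positivity) ?_ M
        rw [← tsum_geometric_of_lt_one h0 h1]
        exact (summable_geometric_of_lt_one h0 h1).sum_le_tsum _ fun _ _ => by positivity

/-- Geometric decay of amplitudes in the total photon number. -/
def HasGeometricDecay (f : (Fin M → ℕ) → ℂ) : Prop :=
  ∃ C ρ : ℝ, 0 < ρ ∧ ρ < 1 ∧ ∀ n, ‖f n‖ ≤ C * ρ ^ (∑ i, n i)

theorem HasGeometricDecay.memℓp {f : (Fin M → ℕ) → ℂ} (hf : HasGeometricDecay f) : Memℓp f 2 := by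
  obtain ⟨C, ρ, h0, h1, h⟩ := hf
  refine (memℓp_two_iff _).2 (Summable.of_nonneg_of_le (fun _ => by positivity) (fun n => ?_)
    ((summable_pow_sum (sq_nonneg ρ) (by nlinarith)).mul_left (C ^ 2)))
  calc ‖f n‖ ^ 2 ≤ (C * ρ ^ (∑ i, n i)) ^ 2 := pow_le_pow_left₀ (norm_nonneg _) (h n) 2
    _ = _ := by rw [mul_pow, ← pow_mul, ← pow_mul, mul_comm 2]

theorem exists_succ_mul_pow_le {ρ : ℝ} (h0 : 0 < ρ) (h1 : ρ < 1) :
    ∃ C ρ' : ℝ, 0 < ρ' ∧ ρ' < 1 ∧ ∀ N : ℕ, ((N : ℝ) + 1) * ρ ^ N ≤ C * ρ' ^ N := by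
  have hs0 : 0 < Real.sqrt ρ := Real.sqrt_pos.2 h0
  have hs1 : Real.sqrt ρ < 1 := by rw [Real.sqrt_lt' one_pos]; simpa
  obtain ⟨C, hC⟩ := (tendsto_self_mul_const_pow_of_lt_one hs0.le hs1).bddAbove_range
  refine ⟨C + 1, Real.sqrt ρ, hs0, hs1, fun N => ?_⟩
  have h2 : (N : ℝ) * Real.sqrt ρ ^ N ≤ C := hC ⟨N, rfl⟩
  have h3 : Real.sqrt ρ ^ N ≤ 1 := pow_le_one₀ hs0.le hs1.le
  calc ((N : ℝ) + 1) * ρ ^ N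
      = ((N : ℝ) * Real.sqrt ρ ^ N + Real.sqrt ρ ^ N) * Real.sqrt ρ ^ N := by
        rw [← add_one_mul, mul_assoc, ← mul_pow, Real.mul_self_sqrt h0.le]
    _ ≤ (C + 1) * Real.sqrt ρ ^ N := by gcongr

/-- A ladder operator costs at most a factor linear in the photon number, which is absorbed by a
slower geometric rate. -/
theorem HasGeometricDecay.of_le {f g : (Fin M → ℕ) → ℂ} (hf : HasGeometricDecay f)
    (h : ∀ C ρ : ℝ, 0 < ρ → 0 ≤ C → (∀ n, ‖f n‖ ≤ C * ρ ^ (∑ i, n i)) → ∃ D, 0 ≤ D ∧ ∀ n,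
      ‖g n‖ ≤ D * ((((∑ i, n i : ℕ) : ℝ) + 1) * ρ ^ (∑ i, n i))) : HasGeometricDecay g := by
  obtain ⟨C, ρ, h0, h1, hC⟩ := hf
  have hC0 : 0 ≤ C := by simpa using (norm_nonneg _).trans (hC 0)
  obtain ⟨D, hD, hg⟩ := h C ρ h0 hC0 hC
  obtain ⟨E, ρ', h2, h3, hE⟩ := exists_succ_mul_pow_le h0 h1
  refine ⟨D * E, ρ', h2, h3, fun n => (hg n).trans ?_⟩
  rw [mul_assoc]
  exact mul_le_mul_of_nonneg_left (hE _) hD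

theorem sqrt_succ_le (i : Fin M) (n : Fin M → ℕ) :
    Real.sqrt ((n i : ℝ) + 1) ≤ ((∑ j, n j : ℕ) : ℝ) + 1 := by
  have h2 : n i ≤ ∑ j, n j := Finset.single_le_sum (fun _ _ => Nat.zero_le _) (Finset.mem_univ i)
  have h3 : (n i : ℝ) ≤ ((∑ j, n j : ℕ) : ℝ) := by exact_mod_cast h2
  refine Real.sqrt_le_iff.2 ⟨by positivity, ?_⟩
  have : (0 : ℝ) ≤ n i := by positivity
  nlinarith

theorem HasGeometricDecay.annihilation {f : (Fin M → ℕ) → ℂ} (hf : HasGeometricDecay f)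
    (i : Fin M) :
    HasGeometricDecay fun n => (Real.sqrt ((n i : ℝ) + 1) : ℂ) * f (addPhoton i n) := by
  refine hf.of_le fun C ρ h0 hC h => ⟨C * ρ, by positivity, fun n => ?_⟩
  rw [norm_mul, Complex.norm_real, Real.norm_of_nonneg (Real.sqrt_nonneg _)]
  calc _ ≤ (((∑ j, n j : ℕ) : ℝ) + 1) * (C * ρ ^ (∑ j, addPhoton i n j)) :=
        mul_le_mul (sqrt_succ_le i n) (h _) (norm_nonneg _) (by positivity)
    _ = _ := by rw [sum_addPhoton, pow_succ]; ring

theorem HasGeometricDecay.creation {f : (Fin M → ℕ) → ℂ} (hf : HasGeometricDecay f)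
    (i : Fin M) :
    HasGeometricDecay fun n => (Real.sqrt (n i : ℝ) : ℂ) * f (removePhoton i n) := by
  refine hf.of_le fun C ρ h0 hC h => ⟨C * ρ⁻¹, by positivity, fun n => ?_⟩
  rw [norm_mul, Complex.norm_real, Real.norm_of_nonneg (Real.sqrt_nonneg _)]
  by_cases hn : n i = 0
  · rw [hn, Nat.cast_zero, Real.sqrt_zero, zero_mul]; positivity
  · obtain ⟨k, rfl⟩ : ∃ k, addPhoton i k = n := ⟨_, addPhoton_removePhoton i n hn⟩
    rw [removePhoton_addPhoton]
    calc _ ≤ (((∑ j, addPhoton i k j : ℕ) : ℝ) + 1) * (C * ρ ^ (∑ j, k j)) :=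
          mul_le_mul ((Real.sqrt_le_sqrt (by linarith)).trans (sqrt_succ_le i _)) (h _)
            (norm_nonneg _) (by positivity)
      _ = _ := by rw [sum_addPhoton, pow_succ]; field_simp

/-- The states with geometrically decaying amplitudes: a dense domain that is stable under all
annihilation and creation operators. -/
def decaying (M : ℕ) : Submodule ℂ (Fock M) where
  carrier := {ψ | HasGeometricDecay (ψ : (Fin M → ℕ) → ℂ)}
  zero_mem' := ⟨0, 1 / 2, by norm_num, by norm_num, fun n => by simp⟩
  add_mem' := by
    rintro ψ χ ⟨C, ρ, h0, h1, h⟩ ⟨D, σ, h2, h3, h'⟩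
    have hC : 0 ≤ C := by simpa using (norm_nonneg _).trans (h 0)
    have hD : 0 ≤ D := by simpa using (norm_nonneg _).trans (h' 0)
    refine ⟨C + D, max ρ σ, lt_max_of_lt_left h0, max_lt h1 h3, fun n => ?_⟩
    rw [lp.coeFn_add, Pi.add_apply, add_mul]
    refine (norm_add_le _ _).trans (add_le_add ((h n).trans ?_) ((h' n).trans ?_))
    · gcongr; exact le_max_left _ _
    · gcongr; exact le_max_right _ _
  smul_mem' := by
    rintro c ψ ⟨C, ρ, h0, h1, h⟩
    refine ⟨‖c‖ * C, ρ, h0, h1, fun n => ?_⟩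
    rw [lp.coeFn_smul, Pi.smul_apply, norm_smul, mul_assoc]
    gcongr
    exact h n

theorem decaying_le_finiteEnergy : decaying M ≤ finiteEnergy M := fun ψ hψ =>
  mem_finiteEnergy_of_annihilation
    (fun i => ⟨_, (HasGeometricDecay.annihilation (f := (ψ : (Fin M → ℕ) → ℂ)) hψ i).memℓp⟩)
    fun _ _ => rfl

/-- A state with geometric decay as a state of finite energy. -/
abbrev decayingE (ψ : decaying M) : finiteEnergy M := ⟨ψ, decaying_le_finiteEnergy ψ.2⟩

theorem ket_mem_decaying_zero : (ket 0 : Fock M) ∈ decaying M := by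
  refine ⟨1, 1 / 2, by norm_num, by norm_num, fun n => ?_⟩
  rw [ket_apply]
  split_ifs with h
  · simp [h]
  · rw [norm_zero]; positivity

/-- `aᵢ` on the states with geometric decay. -/
def annihilationD (i : Fin M) : Module.End ℂ (decaying M) :=
  ((annihilation i).comp (Submodule.inclusion decaying_le_finiteEnergy)).codRestrict (decaying M)
    fun ψ => HasGeometricDecay.annihilation (f := ((ψ : Fock M) : (Fin M → ℕ) → ℂ)) ψ.2 i

/-- `aᵢ†` on the states with geometric decay. -/
def creationD (i : Fin M) : Module.End ℂ (decaying M) :=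
  ((creation i).comp (Submodule.inclusion decaying_le_finiteEnergy)).codRestrict (decaying M)
    fun ψ => HasGeometricDecay.creation (f := ((ψ : Fock M) : (Fin M → ℕ) → ℂ)) ψ.2 i

theorem coe_annihilationD (i : Fin M) (ψ : decaying M) :
    (annihilationD i ψ : Fock M) = annihilation i (decayingE ψ) := rfl

theorem coe_creationD (i : Fin M) (ψ : decaying M) :
    (creationD i ψ : Fock M) = creation i (decayingE ψ) := rfl

theorem lie_annihilationD_creationD (i j : Fin M) :
    ⁅annihilationD i, creationD j⁆ = (if i = j then 1 else 0 : ℂ) • (1 : Module.End ℂ (decaying M)) := by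
  rw [Ring.lie_def, sub_eq_iff_eq_add']
  refine LinearMap.ext fun ψ => Subtype.ext (lp.ext (funext fun m => ?_))
  exact amplitude_commutator i j ((ψ : Fock M) : (Fin M → ℕ) → ℂ) m

theorem lie_annihilationD (i j : Fin M) : ⁅annihilationD i, annihilationD j⁆ = 0 := by
  rw [Ring.lie_def, sub_eq_zero]
  refine LinearMap.ext fun ψ => Subtype.ext (lp.ext (funext fun m => ?_))
  exact amplitude_comm i j ((ψ : Fock M) : (Fin M → ℕ) → ℂ) m

theorem inner_creationD_left (i : Fin M) (χ ψ : decaying M) :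
    inner ℂ (creationD i χ) ψ = inner ℂ χ (annihilationD i ψ) :=
  inner_creation_left i (decayingE χ) (decayingE ψ)

theorem lie_creationD (i j : Fin M) : ⁅creationD i, creationD j⁆ = (0 : Module.End ℂ (decaying M)) := by
  rw [Ring.lie_def, sub_eq_zero]
  refine LinearMap.ext fun ψ => ext_inner_right ℂ fun χ => ?_
  have := LinearMap.congr_fun (sub_eq_zero.1 (lie_annihilationD j i)) χ
  simp only [Module.End.mul_apply] at this ⊢
  simp only [inner_creationD_left, this]

/-- The operator `∑ⱼ (cⱼ aⱼ + dⱼ aⱼ†)` on the states with geometric decay. -/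
def linearFormD (c d : Fin M → ℂ) : Module.End ℂ (decaying M) :=
  ∑ j, (c j • annihilationD j + d j • creationD j)

theorem coe_linearFormD (c d : Fin M → ℂ) (ψ : decaying M) :
    (linearFormD c d ψ : Fock M) = linearForm c d (decayingE ψ) := by
  simp [linearFormD, linearForm, coe_annihilationD, coe_creationD]

theorem lie_linearFormD (c d c' d' : Fin M → ℂ) :
    ⁅linearFormD c d, linearFormD c' d'⁆ =
      (c ⬝ᵥ d' - d ⬝ᵥ c') • (1 : Module.End ℂ (decaying M)) := by
  let _ : LieRing (Module.End ℂ (decaying M)) := LieRing.ofAssociativeRing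
  let _ : LieAlgebra ℂ (Module.End ℂ (decaying M)) := LieAlgebra.ofAssociativeAlgebra
  have h : ∀ i j : Fin M, (⁅creationD i, annihilationD j⁆ : Module.End ℂ (decaying M)) =
      (if i = j then -1 else 0 : ℂ) • (1 : Module.End ℂ (decaying M)) := by
    intro i j
    rw [← lie_skew, lie_annihilationD_creationD, ← neg_smul]
    by_cases hij : i = j
    · simp [hij]
    · simp [hij, Ne.symm hij]
  simp only [linearFormD, sum_lie, lie_sum, add_lie, lie_add, smul_lie, lie_smul,
    lie_annihilationD, lie_creationD, h, lie_annihilationD_creationD, smul_zero, zero_add, add_zero,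
    smul_smul, ← add_smul, ← Finset.sum_smul]
  congr 1
  simp only [dotProduct, mul_ite, mul_one, mul_zero, mul_neg, Finset.sum_add_distrib]
  simp [sub_eq_add_neg, mul_comm, add_comm]

theorem inner_linearFormD_left (c d : Fin M → ℂ) (χ ψ : decaying M) :
    inner ℂ (linearFormD c d χ) ψ = inner ℂ χ (linearFormD (star d) (star c) ψ) := by
  have := inner_linearForm_left c d (decayingE χ) (decayingE ψ)
  rwa [← coe_linearFormD, ← coe_linearFormD] at this

/-! ### Polynomials in creation operators acting on a vacuum -/

/-- `T` represents polynomials as states so that the `bᵢ = ∑ⱼ (Aᵢⱼ aⱼ + Bᵢⱼ aⱼ†)` act as partial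
derivatives and their adjoints as multiplication by the variables. -/
structure IsBargmann (A B : Matrix (Fin M) (Fin M) ℂ)
    (T : MvPolynomial (Fin M) ℂ →ₗ[ℂ] decaying M) : Prop where
  norm_one : ‖T 1‖ = 1
  mul_X : ∀ i p, T (MvPolynomial.X i * p) = linearFormD (star (B i)) (star (A i)) (T p)
  pderiv : ∀ i p, T (MvPolynomial.pderiv i p) = linearFormD (A i) (B i) (T p)

theorem IsBogoliubovPair.lie_annih_creat {A B : Matrix (Fin M) (Fin M) ℂ}
    (h : IsBogoliubovPair A B) (i j : Fin M) :
    ⁅linearFormD (A i) (B i), linearFormD (star (B j)) (star (A j))⁆ =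
      (if i = j then 1 else 0 : ℂ) • (1 : Module.End ℂ (decaying M)) := by
  rw [lie_linearFormD, ← Matrix.one_apply, ← h.comm_adjoint]
  rfl

theorem IsBogoliubovPair.lie_creat {A B : Matrix (Fin M) (Fin M) ℂ}
    (h : IsBogoliubovPair A B) (i j : Fin M) :
    ⁅linearFormD (star (B i)) (star (A i)), linearFormD (star (B j)) (star (A j))⁆ =
      (0 : Module.End ℂ (decaying M)) := by
  have h1 : B i ⬝ᵥ A j - A i ⬝ᵥ B j = 0 :=
    sub_eq_zero.2 (congrFun (congrFun h.comm i) j).symm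
  have h2 := congrArg star h1
  rw [star_sub, ← Matrix.star_dotProduct_star, ← Matrix.star_dotProduct_star, star_zero,
    dotProduct_comm, dotProduct_comm (star (B j))] at h2
  rw [lie_linearFormD, h2, zero_smul]

open scoped IsMulCommutative in
/-- A normalized state that is annihilated by all `bᵢ` generates a representation of polynomials. -/
theorem IsBogoliubovPair.exists_isBargmann {A B : Matrix (Fin M) (Fin M) ℂ}
    (h : IsBogoliubovPair A B) (Ω : decaying M) (hΩ : ‖Ω‖ = 1)
    (hΩ' : ∀ i, linearFormD (A i) (B i) Ω = 0) : ∃ T, IsBargmann A B T ∧ T 1 = Ω := by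
  -- The transformed creation operators commute, so polynomials can be evaluated in the algebra they
  -- generate, and `T p` is `p(b†) Ω`. That `bᵢ` acts as a derivative follows from `bᵢ Ω = 0` and
  -- the commutation relation, which is the Leibniz rule.
  let k : Fin M → Module.End ℂ (decaying M) := fun i => linearFormD (star (B i)) (star (A i))
  let S := Algebra.adjoin ℂ (Set.range k)
  have hS : IsMulCommutative S := by
    refine Algebra.isMulCommutative_adjoin ℂ ?_
    rintro _ ⟨i, rfl⟩ _ ⟨j, rfl⟩
    exact sub_eq_zero.1 (h.lie_creat i j)
  let κ : Fin M → S := fun i => ⟨k i, Algebra.subset_adjoin ⟨i, rfl⟩⟩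
  let T : MvPolynomial (Fin M) ℂ →ₗ[ℂ] decaying M :=
    (LinearMap.applyₗ Ω).comp (S.val.toLinearMap.comp (MvPolynomial.aeval κ).toLinearMap)
  have hT : ∀ p, T p = (MvPolynomial.aeval κ p : S).1 Ω := fun p => rfl
  have h1 : T 1 = Ω := by rw [hT, map_one]; rfl
  have hX : ∀ i p, T (MvPolynomial.X i * p) = k i (T p) := by
    intro i p
    rw [hT, map_mul, MvPolynomial.aeval_X]; rfl
  refine ⟨T, ⟨by rw [h1, hΩ], hX, fun i p => ?_⟩, h1⟩
  induction p using MvPolynomial.induction_on with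
  | C a =>
    rw [MvPolynomial.pderiv_C, map_zero, ← mul_one (MvPolynomial.C a), ← MvPolynomial.smul_eq_C_mul,
      map_smul, map_smul, h1, hΩ', smul_zero]
  | add p q hp hq => rw [map_add, map_add, hp, hq, map_add, map_add]
  | mul_X p j hp =>
    have h2 := LinearMap.congr_fun (sub_eq_iff_eq_add.1 (h.lie_annih_creat i j)) (T p)
    rw [mul_comm p, hX, MvPolynomial.pderiv_mul, MvPolynomial.pderiv_X, map_add, hX, hp]
    refine Eq.trans ?_ h2.symm
    rw [LinearMap.add_apply]
    congr 1
    by_cases hij : i = j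
    · subst hij; simp
    · simp [hij, Ne.symm hij]

theorem IsBargmann.inner_mul_X_left {A B : Matrix (Fin M) (Fin M) ℂ}
    {T : MvPolynomial (Fin M) ℂ →ₗ[ℂ] decaying M} (h : IsBargmann A B T) (i : Fin M)
    (p q : MvPolynomial (Fin M) ℂ) :
    inner ℂ (T (MvPolynomial.X i * p)) (T q) = inner ℂ (T p) (T (MvPolynomial.pderiv i q)) := by
  rw [h.mul_X, h.pderiv, inner_linearFormD_left, star_star, star_star]

theorem IsBargmann.inner_mul_X_right {A B : Matrix (Fin M) (Fin M) ℂ}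
    {T : MvPolynomial (Fin M) ℂ →ₗ[ℂ] decaying M} (h : IsBargmann A B T) (i : Fin M)
    (p q : MvPolynomial (Fin M) ℂ) :
    inner ℂ (T p) (T (MvPolynomial.X i * q)) = inner ℂ (T (MvPolynomial.pderiv i p)) (T q) := by
  rw [h.mul_X, h.pderiv, inner_linearFormD_left]

theorem map_C_eq_smul {E : Type*} [AddCommGroup E] [Module ℂ E]
    (T : MvPolynomial (Fin M) ℂ →ₗ[ℂ] E) (a : ℂ) : T (MvPolynomial.C a) = a • T 1 := by
  rw [← map_smul, MvPolynomial.smul_eq_C_mul, mul_one]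

/-- All representations of the polynomials induce the same inner product. -/
theorem IsBargmann.inner_eq {A B A' B' : Matrix (Fin M) (Fin M) ℂ}
    {T T' : MvPolynomial (Fin M) ℂ →ₗ[ℂ] decaying M} (h : IsBargmann A B T)
    (h' : IsBargmann A' B' T') (p q : MvPolynomial (Fin M) ℂ) :
    inner ℂ (T p) (T q) = inner ℂ (T' p) (T' q) := by
  -- Variables on the left become derivatives on the right until the left argument is constant;
  -- variables on the right then differentiate this constant to zero. Only the norm of `T 1`
  -- remains.
  induction p using MvPolynomial.induction_on generalizing q with
  | C a =>
    induction q using MvPolynomial.induction_on with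
    | C b =>
      simp only [map_C_eq_smul, inner_smul_left, inner_smul_right]
      rw [inner_self_eq_norm_sq_to_K, inner_self_eq_norm_sq_to_K, h.norm_one, h'.norm_one]
    | add q r hq hr => rw [map_add, map_add, inner_add_right, inner_add_right, hq, hr]
    | mul_X q j _ =>
      rw [mul_comm q, h.inner_mul_X_right, h'.inner_mul_X_right, MvPolynomial.pderiv_C, map_zero,
        map_zero, inner_zero_left, inner_zero_left]
  | add p r hp hr => rw [map_add, map_add, inner_add_left, inner_add_left, hp, hr]
  | mul_X p j hp => rw [mul_comm p, h.inner_mul_X_left, h'.inner_mul_X_left, hp]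

theorem IsBargmann.norm_eq {A B A' B' : Matrix (Fin M) (Fin M) ℂ}
    {T T' : MvPolynomial (Fin M) ℂ →ₗ[ℂ] decaying M} (h : IsBargmann A B T)
    (h' : IsBargmann A' B' T') (p : MvPolynomial (Fin M) ℂ) : ‖T p‖ = ‖T' p‖ := by
  rw [@norm_eq_sqrt_re_inner ℂ, @norm_eq_sqrt_re_inner ℂ, h.inner_eq h']

/-- The vacuum as a state with geometric decay. -/
def vacuumD (M : ℕ) : decaying M := ⟨ket 0, ket_mem_decaying_zero⟩

theorem norm_vacuumD : ‖vacuumD M‖ = 1 := by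
  change ‖(ket 0 : Fock M)‖ = 1
  rw [ket, lp.norm_single (by norm_num), norm_one]

theorem annihilationD_vacuumD (i : Fin M) : annihilationD i (vacuumD M) = 0 :=
  Subtype.ext (annihilation_vacuum i)

theorem isBogoliubovPair_one : IsBogoliubovPair (1 : Matrix (Fin M) (Fin M) ℂ) 0 :=
  ⟨by simp, by simp⟩

theorem linearFormD_zero_right_vacuumD (c : Fin M → ℂ) : linearFormD c 0 (vacuumD M) = 0 := by
  simp [linearFormD, annihilationD_vacuumD]

theorem ket_induction {P : (Fin M → ℕ) → Prop} (h0 : P 0) (h : ∀ i n, P n → P (addPhoton i n))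
    (n : Fin M → ℕ) : P n := by
  induction hN : ∑ i, n i generalizing n with
  | zero =>
    have : n = 0 := by
      funext i
      exact (Finset.sum_eq_zero_iff.1 hN) i (Finset.mem_univ i)
    rw [this]; exact h0
  | succ N ih =>
    obtain ⟨i, -, hi⟩ := Finset.exists_ne_zero_of_sum_ne_zero (by omega : ∑ i, n i ≠ 0)
    rw [← addPhoton_removePhoton i n hi] at hN ⊢
    rw [sum_addPhoton] at hN
    exact h i _ (ih _ (by omega))

theorem ofReal_sqrt_succ_ne_zero (k : ℕ) : (Real.sqrt ((k : ℝ) + 1) : ℂ) ≠ 0 := by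
  rw [Ne, Complex.ofReal_eq_zero, Real.sqrt_eq_zero (by positivity)]
  positivity

theorem linearFormD_eq_creationD (i : Fin M) :
    linearFormD (star ((0 : Matrix (Fin M) (Fin M) ℂ) i)) (star ((1 : Matrix (Fin M) (Fin M) ℂ) i)) =
      creationD i := by
  simp [linearFormD, Matrix.one_apply, apply_ite]

theorem linearFormD_eq_annihilationD (i : Fin M) :
    linearFormD ((1 : Matrix (Fin M) (Fin M) ℂ) i) ((0 : Matrix (Fin M) (Fin M) ℂ) i) =
      annihilationD i := by
  simp [linearFormD, Matrix.one_apply]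

theorem exists_polynomial_ket {J : MvPolynomial (Fin M) ℂ →ₗ[ℂ] decaying M}
    (hJ : IsBargmann 1 0 J) (hJ1 : J 1 = vacuumD M) (n : Fin M → ℕ) :
    ∃ p, (J p : Fock M) = ket n := by
  induction n using ket_induction with
  | h0 => exact ⟨1, by rw [hJ1]; rfl⟩
  | h i n ih =>
    obtain ⟨p, hp⟩ := ih
    refine ⟨(Real.sqrt ((n i : ℝ) + 1) : ℂ)⁻¹ • (MvPolynomial.X i * p), ?_⟩
    have h1 : decayingE (J p) = ketE n := Subtype.ext hp
    rw [map_smul, hJ.mul_X, linearFormD_eq_creationD, Submodule.coe_smul, coe_creationD, h1,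
      creation_ketE, smul_smul, inv_mul_cancel₀ (ofReal_sqrt_succ_ne_zero _), one_smul]

theorem denseRange_of_ket {E : Type*} [AddCommGroup E] [Module ℂ E] (J : E →ₗ[ℂ] Fock M)
    (hJ : ∀ n, ∃ p, J p = ket n) : DenseRange J := by
  intro ψ
  refine mem_closure_of_tendsto (hasSum_ket ψ) (Filter.Eventually.of_forall fun s => ?_)
  choose p hp using hJ
  exact ⟨∑ n ∈ s, ψ n • p n, by simp [hp]⟩

theorem linearFormD_combination (c d : Fin M → ℂ) (A B : Matrix (Fin M) (Fin M) ℂ) (ψ : decaying M) :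
    ∑ j, (c j • linearFormD (A j) (B j) ψ + d j • linearFormD (star (B j)) (star (A j)) ψ) =
      linearFormD (c ᵥ* A + d ᵥ* entryConj B) (c ᵥ* B + d ᵥ* entryConj A) ψ := by
  refine Subtype.ext ?_
  rw [coe_linearFormD, ← linearForm_combination]
  simp [coe_linearFormD]

theorem IsBargmann.map_combination {A B : Matrix (Fin M) (Fin M) ℂ}
    {T : MvPolynomial (Fin M) ℂ →ₗ[ℂ] decaying M} (h : IsBargmann A B T) (c d : Fin M → ℂ)
    (p : MvPolynomial (Fin M) ℂ) :
    T (∑ j, (c j • MvPolynomial.pderiv j p + d j • (MvPolynomial.X j * p))) =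
      linearFormD (c ᵥ* A + d ᵥ* entryConj B) (c ᵥ* B + d ᵥ* entryConj A) (T p) := by
  simp only [map_sum, map_add, map_smul, h.pderiv, h.mul_X, linearFormD_combination]

/-! ### Implementing Bogoliubov transformations by unitaries -/

/-- A vacuum for the inverse transformation yields an isometry that implements it. -/
theorem IsBogoliubovPair.exists_isometry {A B : Matrix (Fin M) (Fin M) ℂ}
    (h : IsBogoliubovPair A B) (Ω : decaying M) (hΩ : ‖Ω‖ = 1)
    (hΩ' : ∀ i, linearFormD (Aᴴ i) ((-Bᵀ) i) Ω = 0) :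
    ∃ G : Fock M →L[ℂ] Fock M, (∀ ψ, ‖G ψ‖ = ‖ψ‖) ∧ Intertwines G A B ∧ G (ket 0) = Ω := by
  -- The inverse pair enters because `G |0⟩` is annihilated by `G aᵢ G⁻¹`, whose coefficients are
  -- those of the inverse.
  obtain ⟨T, hT, hT1⟩ := h.inv.exists_isBargmann Ω hΩ hΩ'
  obtain ⟨J, hJ, hJ1⟩ := (isBogoliubovPair_one (M := M)).exists_isBargmann (vacuumD M) norm_vacuumD
    fun i => by rw [linearFormD_eq_annihilationD, annihilationD_vacuumD]
  let J' := (decaying M).subtype.comp J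
  let T' := (decaying M).subtype.comp T
  have hket : ∀ n, ∃ p, J' p = ket n := exists_polynomial_ket hJ hJ1
  have hdense : DenseRange J' := denseRange_of_ket J' hket
  have hnorm : ∀ p, ‖T' p‖ = ‖J' p‖ := fun p => hT.norm_eq hJ p
  let G : Fock M →L[ℂ] Fock M := T'.extendOfNorm J'
  have hG : ∀ p, G (J p) = (T p : Fock M) := fun p =>
    LinearMap.extendOfNorm_eq hdense ⟨1, fun p => by rw [one_mul, hnorm]⟩ p
  have hG_iso : ∀ ψ, ‖G ψ‖ = ‖ψ‖ := fun ψ => by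
    refine hdense.induction_on (p := fun ψ => ‖G ψ‖ = ‖ψ‖) ψ
      (isClosed_eq (by fun_prop) (by fun_prop)) fun p => ?_
    exact (congrArg _ (hG p)).trans (hnorm p)
  have hlin : ∀ (c d : Fin M → ℂ) (p : MvPolynomial (Fin M) ℂ),
      G (linearForm c d (decayingE (J p))) =
        linearForm (c ᵥ* Aᴴ + d ᵥ* entryConj (-Bᵀ)) (c ᵥ* (-Bᵀ) + d ᵥ* entryConj Aᴴ)
          (decayingE (T p)) := by
    intro c d p
    rw [← coe_linearFormD, ← coe_linearFormD, ← hT.map_combination, ← hG, hJ.map_combination]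
    simp
  have hmem : ∀ n, G (ket n) ∈ finiteEnergy M := by
    intro n
    obtain ⟨p, hp⟩ := hket n
    rw [← hp]
    change G (J p) ∈ _
    rw [hG]
    exact (decayingE (T p)).2
  have hconj : entryConj (-Bᵀ) = -Bᴴ := by ext; simp
  have hconj' : entryConj Aᴴ = Aᵀ := by ext; simp
  have h1' : A * Aᴴ + B * entryConj (-Bᵀ) = 1 := by
    rw [hconj, Matrix.mul_neg, ← sub_eq_add_neg, h.comm_adjoint]
  have h2' : A * (-Bᵀ) + B * entryConj Aᴴ = 0 := by
    rw [hconj', Matrix.mul_neg, h.comm, neg_add_cancel]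
  have h3' : entryConj B * Aᴴ + entryConj A * entryConj (-Bᵀ) = 0 := by
    rw [hconj, Matrix.mul_neg, h.entryConj_mul.2, add_neg_cancel]
  have h4' : entryConj B * (-Bᵀ) + entryConj A * entryConj Aᴴ = 1 := by
    rw [hconj', Matrix.mul_neg, neg_add_eq_sub, h.entryConj_mul.1]
  refine ⟨G, hG_iso, Intertwines.of_ket G A B hmem (fun i n => ?_) fun i n => ?_, ?_⟩
  · obtain ⟨p, hp⟩ := hket n
    have h1 : ketE n = decayingE (J p) := Subtype.ext hp.symm
    have h2 : (⟨G (ket n), hmem n⟩ : finiteEnergy M) = decayingE (T p) :=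
      Subtype.ext ((congrArg G hp.symm).trans (hG p))
    rw [h2, h1, hlin, ← linearForm_single_left]
    exact congrArg₂ (fun c d => linearForm c d (decayingE (T p)))
      (((congrFun h1' i).trans (funext fun _ => Matrix.one_eq_pi_single)).symm)
      (congrFun h2' i).symm
  · obtain ⟨p, hp⟩ := hket n
    have h1 : ketE n = decayingE (J p) := Subtype.ext hp.symm
    have h2 : (⟨G (ket n), hmem n⟩ : finiteEnergy M) = decayingE (T p) :=
      Subtype.ext ((congrArg G hp.symm).trans (hG p))
    rw [h2, h1, hlin, ← linearForm_single_right]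
    exact congrArg₂ (fun c d => linearForm c d (decayingE (T p)))
      (congrFun h3' i).symm
      (((congrFun h4' i).trans (funext fun _ => Matrix.one_eq_pi_single)).symm)
  · rw [← hT1, ← hG, hJ1]; rfl

theorem Intertwines.comp {G H : Fock M →L[ℂ] Fock M} {A B A' B' : Matrix (Fin M) (Fin M) ℂ}
    (hG : Intertwines G A B) (hH : Intertwines H A' B') :
    Intertwines (G.comp H) (A * A' + B * entryConj B') (A * B' + B * entryConj A') where
  mem ψ hψ := hG.mem _ (hH.mem _ hψ)
  annih i ψ := (hG.annih i ⟨H ψ, hH.mem _ ψ.2⟩).trans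
    (congrArg G (hH.linearForm_map (A i) (B i) ψ))
  creat i ψ := by
    refine ((hG.creat i ⟨H ψ, hH.mem _ ψ.2⟩).trans
      (congrArg G (hH.linearForm_map (star (B i)) (star (A i)) ψ))).trans ?_
    refine congrArg₂ (fun c d => G (H (linearForm c d ψ))) ?_ ?_ <;>
    · ext k
      simp [Matrix.vecMul, dotProduct, Matrix.mul_apply, add_comm]

/-- An isometry that commutes with all annihilation and creation operators is a scalar. -/
theorem Intertwines.exists_eq_smul {K : Fock M →L[ℂ] Fock M} (hK : Intertwines K 1 0)
    (hK' : ∀ ψ, ‖K ψ‖ = ‖ψ‖) : ∃ c : ℂ, c ≠ 0 ∧ ∀ ψ, K ψ = c • ψ := by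
  have hannih : ∀ i (ψ : finiteEnergy M), annihilation i ⟨K ψ, hK.mem _ ψ.2⟩ = K (annihilation i ψ) :=
    fun i ψ => by
      rw [hK.annih, ← linearForm_single_left]
      exact congrArg (fun c => K (linearForm c 0 ψ)) (funext fun _ => Matrix.one_eq_pi_single)
  have hcreat : ∀ i (ψ : finiteEnergy M), creation i ⟨K ψ, hK.mem _ ψ.2⟩ = K (creation i ψ) :=
    fun i ψ => by
      rw [hK.creat, ← linearForm_single_right]
      refine congrArg₂ (fun c d => K (linearForm c d ψ)) (by ext; simp) ?_
      ext j
      simp [Matrix.one_apply, Pi.single_apply, eq_comm, apply_ite]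
  -- The state `K |0⟩` is annihilated by every `aᵢ`, so it has no amplitude outside `n = 0`.
  -- Creation operators then carry the scalar to all number states.
  obtain ⟨c, hc⟩ : ∃ c : ℂ, K (ket 0) = c • ket 0 := by
    refine ⟨K (ket 0) 0, ?_⟩
    ext n
    rw [lp.coeFn_smul, Pi.smul_apply, ket_apply, smul_eq_mul]
    split_ifs with hn
    · rw [hn, mul_one]
    · obtain ⟨i, hi⟩ : ∃ i, n i ≠ 0 := by
        by_contra! h
        exact hn (funext h)
      have h1 := hannih i (ketE 0)
      rw [annihilation_vacuum, map_zero] at h1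
      have h2 := congrArg (fun ψ : Fock M => ψ (removePhoton i n)) h1
      simp only [annihilation_apply, addPhoton_removePhoton i n hi] at h2
      rw [mul_zero]
      exact (mul_eq_zero.1 h2).resolve_left (ofReal_sqrt_succ_ne_zero _)
  have hket : ∀ n, K (ket n) = c • ket n := by
    intro n
    induction n using ket_induction with
    | h0 => exact hc
    | h i n ih =>
      have h1 := hcreat i (ketE n)
      have h2 : (⟨K (ketE n : finiteEnergy M), hK.mem _ (ketE n).2⟩ : finiteEnergy M) = c • ketE n :=
        Subtype.ext ih
      rw [h2, map_smul, creation_ketE, map_smul, smul_comm] at h1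
      exact (smul_right_injective _ (ofReal_sqrt_succ_ne_zero (n i)) h1).symm
  refine ⟨c, ?_, fun ψ => ?_⟩
  · rintro rfl
    have h1 := hK' (ket 0)
    rw [hc, zero_smul, norm_zero, ket, lp.norm_single (by norm_num), norm_one] at h1
    exact zero_ne_one h1
  · refine ((hasSum_ket ψ).mapL K).unique ?_
    convert (hasSum_ket ψ).const_smul c using 2 with n
    rw [map_smul, hket, smul_comm]

theorem IsBogoliubovPair.intertwines_comp {A B : Matrix (Fin M) (Fin M) ℂ}
    (h : IsBogoliubovPair A B) {G G' : Fock M →L[ℂ] Fock M} (hG : Intertwines G A B)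
    (hG' : Intertwines G' Aᴴ (-Bᵀ)) : Intertwines (G'.comp G) 1 0 := by
  have h1 := hG'.comp hG
  rwa [Matrix.neg_mul, Matrix.neg_mul, ← sub_eq_add_neg, ← sub_eq_add_neg, h.inverse_mul.1,
    h.inverse_mul.2, sub_self] at h1

/-- A Bogoliubov transformation is implemented by a unitary as soon as it and its inverse have
vacua with geometric decay. -/
theorem IsBogoliubovPair.exists_unitary {A B : Matrix (Fin M) (Fin M) ℂ}
    (h : IsBogoliubovPair A B) (Ω Ω' : decaying M) (hΩ : ‖Ω‖ = 1) (hΩ' : ‖Ω'‖ = 1)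
    (h1 : ∀ i, linearFormD (Aᴴ i) ((-Bᵀ) i) Ω = 0) (h2 : ∀ i, linearFormD (A i) (B i) Ω' = 0) :
    ∃ U : Fock M ≃ₗᵢ[ℂ] Fock M, HasBogoliubov U A B ∧ U (vacuum M) = Ω := by
  have hA : Aᴴᴴ = A := Matrix.conjTranspose_conjTranspose A
  have hB : -(-Bᵀ)ᵀ = B := by simp
  obtain ⟨G, hG, hGI, hG0⟩ := h.exists_isometry Ω hΩ h1
  obtain ⟨G', hG', hGI', -⟩ := h.inv.exists_isometry Ω' hΩ' (by rw [hA, hB]; exact h2)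
  -- The phases of `Ω` and `Ω'` are unrelated, so `G'` inverts `G` only up to the scalar `c`.
  have h3 : Intertwines (G.comp G') 1 0 :=
    h.inv.intertwines_comp hGI' (by rw [hA, hB]; exact hGI)
  obtain ⟨c, hc, hGG'⟩ := h3.exists_eq_smul fun ψ => (hG _).trans (hG' ψ)
  have hinv : ∀ ψ, G (c⁻¹ • G' ψ) = ψ := fun ψ => by
    rw [map_smul]
    change c⁻¹ • (G.comp G') ψ = ψ
    rw [hGG', smul_smul, inv_mul_cancel₀ hc, one_smul]
  let U : Fock M ≃ₗᵢ[ℂ] Fock M := LinearIsometryEquiv.ofSurjective ⟨G.toLinearMap, hG⟩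
    fun ψ => ⟨_, hinv ψ⟩
  have hU : toCLM U = G := rfl
  refine ⟨U, Intertwines.hasBogoliubov (by rw [hU]; exact hGI) fun ψ hψ => ?_, hG0⟩
  have h4 : U.symm ψ = c⁻¹ • G' ψ := by
    rw [LinearIsometryEquiv.symm_apply_eq]; exact (hinv ψ).symm
  rw [h4]
  exact Submodule.smul_mem _ _ (hGI'.mem _ hψ)

/-- Every unitary matrix is implemented by a linear-optical circuit. -/
theorem exists_linearOptical {V : Matrix (Fin M) (Fin M) ℂ} (hV : V ∈ Matrix.unitaryGroup (Fin M) ℂ) :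
    ∃ U : Fock M ≃ₗᵢ[ℂ] Fock M, HasBogoliubov U V 0 := by
  have h : IsBogoliubovPair V 0 := ⟨by
    simpa [Matrix.star_eq_conjTranspose] using Matrix.mem_unitaryGroup_iff.1 hV, by simp⟩
  obtain ⟨U, hU, -⟩ := h.exists_unitary (vacuumD M) (vacuumD M) norm_vacuumD norm_vacuumD
    (fun i => by rw [Matrix.transpose_zero, neg_zero]; exact linearFormD_zero_right_vacuumD _)
    fun i => linearFormD_zero_right_vacuumD _
  exact ⟨U, hU⟩

/-! ### Squeezed vacua and squeezing gates -/

/-- The amplitudes of the unnormalized single-mode squeezed vacuum `exp (t a†² / 2) |0⟩`. -/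
def squeezedAmplitude (t : ℝ) : ℕ → ℝ
  | 0 => 1
  | 1 => 0
  | n + 2 => t * Real.sqrt (((n : ℝ) + 1) / ((n : ℝ) + 2)) * squeezedAmplitude t n

/-- This is `a ψ = t a† ψ` on amplitudes. At `n = 0` the truncated `n - 1` is harmless because of
the factor `√0`. -/
theorem sqrt_mul_squeezedAmplitude (t : ℝ) (n : ℕ) :
    Real.sqrt ((n : ℝ) + 1) * squeezedAmplitude t (n + 1) =
      t * (Real.sqrt n * squeezedAmplitude t (n - 1)) := by
  cases n with
  | zero => simp [squeezedAmplitude]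
  | succ n =>
    rw [Nat.add_sub_cancel, squeezedAmplitude, Real.sqrt_div (by positivity)]
    have h1 : (((n + 1 : ℕ) : ℝ) + 1) = (n : ℝ) + 2 := by push_cast; ring
    have h2 : Real.sqrt ((n : ℝ) + 2) ≠ 0 := (Real.sqrt_pos.2 (by positivity)).ne'
    rw [h1]
    push_cast
    field_simp

theorem abs_squeezedAmplitude_le {t ρ : ℝ} (hρ : 0 ≤ ρ) (h : |t| ≤ ρ ^ 2) (n : ℕ) :
    |squeezedAmplitude t n| ≤ ρ ^ n := by
  induction n using Nat.twoStepInduction with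
  | zero => simp [squeezedAmplitude]
  | one => simpa [squeezedAmplitude] using hρ
  | more n ih _ =>
    have h1 : Real.sqrt (((n : ℝ) + 1) / ((n : ℝ) + 2)) ≤ 1 := by
      rw [Real.sqrt_le_iff, one_pow, div_le_one (by positivity)]
      exact ⟨zero_le_one, by linarith⟩
    rw [squeezedAmplitude, abs_mul, abs_mul, abs_of_nonneg (Real.sqrt_nonneg _), pow_add, mul_comm (ρ ^ n)]
    refine mul_le_mul ?_ ih (abs_nonneg _) (by positivity)
    calc _ ≤ ρ ^ 2 * 1 := mul_le_mul h h1 (Real.sqrt_nonneg _) (by positivity)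
      _ = ρ ^ 2 := mul_one _

/-- One rate close to 1 serves all of the finitely many modes. The square appears because each step
of the amplitude recursion adds two photons. -/
theorem exists_pow_two_ge (t : Fin M → ℝ) (ht : ∀ i, |t i| < 1) :
    ∃ ρ : ℝ, 0 < ρ ∧ ρ < 1 ∧ ∀ i, |t i| ≤ ρ ^ 2 := by
  have h1 : ∀ᶠ ρ : ℝ in nhdsWithin 1 (Set.Iio 1), ∀ i, |t i| < ρ ^ 2 := by
    refine Filter.eventually_all.2 fun i => ?_
    have h2 : Filter.Tendsto (fun ρ : ℝ => ρ ^ 2) (nhdsWithin 1 (Set.Iio 1)) (nhds (1 ^ 2)) :=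
      ((continuous_pow 2).tendsto 1).mono_left nhdsWithin_le_nhds
    exact h2.eventually_const_lt (by simpa using ht i)
  have h3 : ∀ᶠ ρ : ℝ in nhdsWithin 1 (Set.Iio 1), 0 < ρ :=
    nhdsWithin_le_nhds (lt_mem_nhds one_pos)
  obtain ⟨ρ, h4, h5, h6⟩ := (h1.and (h3.and self_mem_nhdsWithin)).exists
  exact ⟨ρ, h5, h6, fun i => (h4 i).le⟩

/-- The normalized squeezed vacuum, which is annihilated by `cosh rᵢ aᵢ - sinh rᵢ aᵢ†`. -/
theorem exists_squeezedVacuum (r : Fin M → ℝ) :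
    ∃ Ω : decaying M, ‖Ω‖ = 1 ∧ (∃ c : ℝ, 0 < c ∧ (Ω : Fock M) 0 = c) ∧
      ∀ i, (Real.cosh (r i) : ℂ) • annihilationD i Ω = (Real.sinh (r i) : ℂ) • creationD i Ω := by
  let t : Fin M → ℝ := fun i => Real.tanh (r i)
  let f : (Fin M → ℕ) → ℝ := fun n => ∏ i, squeezedAmplitude (t i) (n i)
  obtain ⟨ρ, h0, h1, hρ⟩ := exists_pow_two_ge t fun i =>
    abs_lt.2 ⟨Real.neg_one_lt_tanh _, Real.tanh_lt_one _⟩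
  have hf : HasGeometricDecay fun n => (f n : ℂ) := by
    refine ⟨1, ρ, h0, h1, fun n => ?_⟩
    rw [Complex.norm_real, Real.norm_eq_abs, one_mul, ← Finset.prod_pow_eq_pow_sum, Finset.abs_prod]
    exact Finset.prod_le_prod (fun _ _ => abs_nonneg _)
      fun i _ => abs_squeezedAmplitude_le h0.le (hρ i) _
  have hupdate : ∀ n i k, f (Function.update n i k) =
      squeezedAmplitude (t i) k * ∏ j ∈ Finset.univ \ {i}, squeezedAmplitude (t j) (n j) := by
    intro n i k
    rw [← Finset.prod_update_of_mem (Finset.mem_univ i)]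
    refine Finset.prod_congr rfl fun j _ => ?_
    exact Function.apply_update (fun j => squeezedAmplitude (t j)) n i k j
  have hf0 : f 0 = 1 := Finset.prod_eq_one fun i _ => rfl
  let Ω : decaying M := ⟨⟨fun n => (f n : ℂ), hf.memℓp⟩, hf⟩
  have hΩ0 : (Ω : Fock M) 0 = 1 := by
    change (f 0 : ℂ) = 1
    rw [hf0]; simp
  have hΩ : Ω ≠ 0 := by
    intro h
    rw [h] at hΩ0
    exact zero_ne_one hΩ0
  have hann : ∀ i, (Real.cosh (r i) : ℂ) • annihilationD i Ω =
      (Real.sinh (r i) : ℂ) • creationD i Ω := by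
    intro i
    refine Subtype.ext (lp.ext (funext fun n => ?_))
    change (Real.cosh (r i) : ℂ) * ((Real.sqrt ((n i : ℝ) + 1) : ℂ) * (f (addPhoton i n) : ℂ)) =
      (Real.sinh (r i) : ℂ) * ((Real.sqrt (n i : ℝ) : ℂ) * (f (removePhoton i n) : ℂ))
    norm_cast
    have h2 := sqrt_mul_squeezedAmplitude (t i) (n i)
    have h3 : Real.cosh (r i) * t i = Real.sinh (r i) := by
      simp only [t]
      rw [Real.tanh_eq_sinh_div_cosh, mul_div_cancel₀ _ (Real.cosh_pos _).ne']
    rw [addPhoton, removePhoton, hupdate, hupdate, ← h3]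
    push_cast
    linear_combination Real.cosh (r i) *
      (∏ j ∈ Finset.univ \ {i}, squeezedAmplitude (t j) (n j)) * h2
  have hn : 0 < ‖Ω‖⁻¹ := inv_pos.2 (norm_pos_iff.2 hΩ)
  refine ⟨((‖Ω‖⁻¹ : ℝ) : ℂ) • Ω, ?_, ⟨‖Ω‖⁻¹, hn, ?_⟩, fun i => ?_⟩
  · rw [norm_smul, Complex.norm_real, norm_inv, norm_norm, inv_mul_cancel₀ (norm_ne_zero_iff.2 hΩ)]
  · rw [Submodule.coe_smul, lp.coeFn_smul, Pi.smul_apply, hΩ0, smul_eq_mul, mul_one]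
  · rw [map_smul, map_smul, smul_comm, hann, smul_comm]

theorem linearFormD_diagonal (u v : Fin M → ℂ) (i : Fin M) (ψ : decaying M) :
    linearFormD (Matrix.diagonal u i) (Matrix.diagonal v i) ψ =
      u i • annihilationD i ψ + v i • creationD i ψ := by
  simp [linearFormD, Matrix.diagonal_apply, Finset.sum_add_distrib]

/-- The product of single-mode squeezing gates exists. -/
theorem exists_isSqueezing (r : Fin M → ℝ) : ∃ S : Fock M ≃ₗᵢ[ℂ] Fock M, IsSqueezing r S := by
  have h : IsBogoliubovPair (Matrix.diagonal fun i => (Real.cosh (r i) : ℂ))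
      (Matrix.diagonal fun i => (Real.sinh (r i) : ℂ)) := by
    constructor
    · rw [Matrix.diagonal_conjTranspose, Matrix.diagonal_conjTranspose,
        Matrix.diagonal_mul_diagonal, Matrix.diagonal_mul_diagonal, Matrix.diagonal_sub,
        ← Matrix.diagonal_one]
      congr 1
      ext i
      simp only [Pi.star_apply, Complex.star_def, Complex.conj_ofReal]
      have := Real.cosh_sq_sub_sinh_sq (r i)
      norm_cast
      rw [← this]; ring
    · rw [Matrix.diagonal_transpose, Matrix.diagonal_transpose, Matrix.diagonal_mul_diagonal,
        Matrix.diagonal_mul_diagonal]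
      congr 1
      ext i
      ring
  obtain ⟨Ω, hΩ, ⟨c, hc, hc'⟩, hΩa⟩ := exists_squeezedVacuum r
  -- Inverting the squeezing changes the sign of `r`: `Ω` becomes `S |0⟩`, while `Ω'` is the vacuum
  -- for the pair itself.
  obtain ⟨Ω', hΩ', -, hΩa'⟩ := exists_squeezedVacuum (-r)
  obtain ⟨S, hS, hS0⟩ := h.exists_unitary Ω Ω' hΩ hΩ'
    (fun i => by
      rw [Matrix.diagonal_conjTranspose, Matrix.diagonal_transpose, Matrix.diagonal_neg,
        linearFormD_diagonal]
      rw [Pi.star_apply, Complex.star_def, Complex.conj_ofReal, hΩa, neg_smul, add_neg_cancel])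
    fun i => by
      rw [linearFormD_diagonal]
      have := hΩa' i
      simp only [Pi.neg_apply, Real.cosh_neg, Real.sinh_neg, Complex.ofReal_neg, neg_smul] at this
      rw [this, neg_add_cancel]
  refine ⟨S, hS, c, hc, ?_⟩
  rw [hS0]
  exact (inner_ket 0 _).trans hc'

/-! ### Rank bounds and the decomposition on Fock space -/

theorem matrix_rank_add_le (X Y : Matrix (Fin M) (Fin M) ℂ) : (X + Y).rank ≤ X.rank + Y.rank := by
  rw [Matrix.rank, Matrix.rank, Matrix.rank, Matrix.mulVecLin_add]
  exact (Submodule.finrank_mono (LinearMap.range_add_le _ _)).trans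
    (Submodule.finrank_add_le_finrank_add_finrank _ _)

theorem rank_mul_diagonal_mul_le (X Y : Matrix (Fin M) (Fin M) ℂ) (d : Fin M → ℂ)
    (s : Finset (Fin M)) (h : ∀ i ∉ s, d i = 0) : (X * Matrix.diagonal d * Y).rank ≤ s.card := by
  classical
  refine (Matrix.rank_mul_le_left _ _).trans ((Matrix.rank_mul_le_right _ _).trans ?_)
  rw [Matrix.rank_diagonal, Fintype.card_subtype]
  refine Finset.card_le_card fun i hi => ?_
  by_contra h'
  exact (Finset.mem_filter.1 hi).2 (h i h')

/-- A Gaussian conjugate of a phase shifter is a low-rank perturbation of the identity. -/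
theorem HasBogoliubov.conj_phaseShifter {G : Fock M ≃ₗᵢ[ℂ] Fock M}
    {A B : Matrix (Fin M) (Fin M) ℂ} (hG : HasBogoliubov G A B) (φ : Fin M → ℝ) :
    ∃ W Z : Matrix (Fin M) (Fin M) ℂ, HasBogoliubov (G⁻¹ * phaseShifter φ * G) (1 + W) Z ∧
      W.rank ≤ 2 * (Finset.univ.filter fun j => φ j ≠ 0).card ∧
      Z.rank ≤ 2 * (Finset.univ.filter fun j => φ j ≠ 0).card := by
  let d : Fin M → ℂ := fun i => Complex.exp (φ i * Complex.I) - 1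
  have hd : ∀ i ∉ Finset.univ.filter fun j => φ j ≠ 0, d i = 0 := by
    intro i hi
    have : φ i = 0 := by simpa using hi
    simp [d, this]
  have hd' : ∀ i ∉ Finset.univ.filter fun j => φ j ≠ 0, star d i = 0 := fun i hi => by
    rw [Pi.star_apply, hd i hi, star_zero]
  have hE : (Matrix.diagonal fun i => Complex.exp (φ i * Complex.I)) = 1 + Matrix.diagonal d := by
    rw [← Matrix.diagonal_one, Matrix.diagonal_add]
    congr 1
    ext i
    simp [d]
  have hE' : entryConj (1 + Matrix.diagonal d) = 1 + Matrix.diagonal (star d) := by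
    rw [← Matrix.diagonal_one, Matrix.diagonal_add, Matrix.diagonal_add, entryConj,
      Matrix.diagonal_map (map_zero _)]
    congr 1
    ext i
    simp
  have h0 : entryConj (0 : Matrix (Fin M) (Fin M) ℂ) = 0 := by ext; simp
  have h := (hG.inv.mul (phaseShifter_hasBogoliubov φ)).mul hG
  rw [hE, hE', h0, Matrix.mul_zero, Matrix.mul_zero, add_zero, zero_add] at h
  -- The identity parts of `1 + D` and `1 + D̄` recombine to the matrices of `G⁻¹ G`, namely 1 and
  -- 0, so only the two terms containing `d` or its conjugate survive in each block.
  obtain ⟨h1, h2⟩ := hG.isBogoliubovPair.inverse_mul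
  have h3 : ∀ X Y P Q R S : Matrix (Fin M) (Fin M) ℂ,
      X * (1 + P) * Y + -R * (1 + Q) * S = X * Y - R * S + (X * P * Y + -R * Q * S) := by
    intro X Y P Q R S; noncomm_ring
  rw [h3, h3, h1, h2, sub_self, zero_add] at h
  refine ⟨Aᴴ * Matrix.diagonal d * A + -Bᵀ * Matrix.diagonal (star d) * entryConj B,
    Aᴴ * Matrix.diagonal d * B + -Bᵀ * Matrix.diagonal (star d) * entryConj A, h, ?_, ?_⟩
  all_goals
    rw [two_mul]
    exact (matrix_rank_add_le _ _).trans (add_le_add (rank_mul_diagonal_mul_le _ _ _ _ hd)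
      (rank_mul_diagonal_mul_le _ _ _ _ hd'))

/-- The Bloch-Messiah decomposition of a Gaussian unitary. -/
theorem HasBogoliubov.exists_blochMessiah {G : Fock M ≃ₗᵢ[ℂ] Fock M}
    {A B : Matrix (Fin M) (Fin M) ℂ} (hG : HasBogoliubov G A B) :
    ∃ (U S V : Fock M ≃ₗᵢ[ℂ] Fock M) (r : Fin M → ℝ),
      IsLinearOptical U ∧ IsSqueezing r S ∧ IsLinearOptical V ∧
      (Finset.univ.filter fun i => r i ≠ 0).card ≤ B.rank ∧ G = U * S * V := by
  obtain ⟨u, hu, v, hv, r, hA, hB⟩ := hG.isBogoliubovPair.exists_blochMessiah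
  obtain ⟨V, hV⟩ := exists_linearOptical hv
  obtain ⟨S, hS⟩ := exists_isSqueezing r
  have hvv : v * vᴴ = 1 := Matrix.mem_unitaryGroup_iff.1 hv
  have hvv' : entryConj v * entryConj vᴴ = 1 := by
    rw [entryConj, entryConj, ← Matrix.map_mul, hvv]; simp
  have h0 : entryConj (0 : Matrix (Fin M) (Fin M) ℂ) = 0 := by ext; simp
  -- The first factor is defined as a quotient, which makes the factorization exact; it remains to
  -- check that its matrices are `u` and 0.
  refine ⟨G * V⁻¹ * S⁻¹, S, V, r, ⟨u, hu, ?_⟩, hS, ⟨v, hv, hV⟩, ?_, by group⟩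
  · have h := (hG.mul hV.inv).mul hS.bogoliubov.inv
    have h1 : A * vᴴ + B * entryConj (-0ᵀ) =
        u * Matrix.diagonal fun i => (Real.cosh (r i) : ℂ) := by
      rw [Matrix.transpose_zero, neg_zero, h0, Matrix.mul_zero, add_zero, hA, Matrix.mul_assoc, hvv,
        Matrix.mul_one]
    have h2 : A * -0ᵀ + B * entryConj vᴴ =
        u * Matrix.diagonal fun i => (Real.sinh (r i) : ℂ) := by
      rw [Matrix.transpose_zero, neg_zero, Matrix.mul_zero, zero_add, hB, Matrix.mul_assoc, hvv',
        Matrix.mul_one]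
    rw [h1, h2] at h
    have hc : (Matrix.diagonal fun i => (Real.cosh (r i) : ℂ))ᴴ =
        Matrix.diagonal fun i => (Real.cosh (r i) : ℂ) := by
      rw [Matrix.diagonal_conjTranspose]; congr 1; ext i
      simp only [Pi.star_apply, Complex.star_def, Complex.conj_ofReal]
    have hc' : entryConj (Matrix.diagonal fun i => (Real.cosh (r i) : ℂ)) =
        Matrix.diagonal fun i => (Real.cosh (r i) : ℂ) := by
      rw [entryConj, Matrix.diagonal_map (map_zero _)]; congr 1; ext i
      simp only [Complex.conj_ofReal]
    have hs' : entryConj (-(Matrix.diagonal fun i => (Real.sinh (r i) : ℂ))ᵀ) =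
        -Matrix.diagonal fun i => (Real.sinh (r i) : ℂ) := by
      rw [Matrix.diagonal_transpose, Matrix.diagonal_neg, entryConj,
        Matrix.diagonal_map (map_zero _)]; congr 1; ext i
      simp only [map_neg, Complex.conj_ofReal]
    have hcs : (Matrix.diagonal fun i => (Real.cosh (r i) : ℂ)) *
        (Matrix.diagonal fun i => (Real.cosh (r i) : ℂ)) -
        (Matrix.diagonal fun i => (Real.sinh (r i) : ℂ)) *
        (Matrix.diagonal fun i => (Real.sinh (r i) : ℂ)) = 1 := by
      have := hS.bogoliubov.isBogoliubovPair.comm_adjoint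
      rw [hc] at this
      convert this using 3
      rw [Matrix.diagonal_conjTranspose]; congr 1; ext i
      simp only [Pi.star_apply, Complex.star_def, Complex.conj_ofReal]
    rw [hc, hc', hs', Matrix.diagonal_transpose] at h
    convert h using 1
    · rw [Matrix.mul_neg, ← sub_eq_add_neg, Matrix.mul_assoc, Matrix.mul_assoc, ← Matrix.mul_sub, hcs,
        Matrix.mul_one]
    · rw [Matrix.mul_neg, Matrix.mul_assoc, Matrix.mul_assoc, Matrix.diagonal_mul_diagonal,
        Matrix.diagonal_mul_diagonal]
      simp only [mul_comm, neg_add_cancel]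
  · have h : uᴴ * B * entryConj vᴴ = Matrix.diagonal fun i => (Real.sinh (r i) : ℂ) := by
      have huu : uᴴ * u = 1 := Matrix.mem_unitaryGroup_iff'.1 hu
      rw [hB, Matrix.mul_assoc, Matrix.mul_assoc, hvv', Matrix.mul_one, ← Matrix.mul_assoc, huu,
        Matrix.one_mul]
    have h3 : (uᴴ * B * entryConj vᴴ).rank ≤ B.rank :=
      (Matrix.rank_mul_le_left _ _).trans (Matrix.rank_mul_le_right _ _)
    classical
    rw [h, Matrix.rank_diagonal, Fintype.card_subtype] at h3
    refine (Finset.card_le_card fun i hi => ?_).trans h3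
    have : r i ≠ 0 := (Finset.mem_filter.1 hi).2
    rw [Finset.mem_filter]
    exact ⟨Finset.mem_univ i, by rwa [Ne, Complex.ofReal_eq_zero, Real.sinh_eq_zero]⟩

end Bosonic

end

open Bosonic in
/-- For a unitary `G` of the Fock space, `G⁻¹` is the adjoint `G†`. -/
theorem mainTheorem7 (M L : ℕ) (G₀ : Fock M ≃ₗᵢ[ℂ] Fock M) (hG₀ : IsGaussianUnitary G₀)
    (φ : Fin M → ℝ) (hφ : (Finset.univ.filter fun j => φ j ≠ 0).card ≤ L) :
    (∃ (U S V : Fock M ≃ₗᵢ[ℂ] Fock M) (r : Fin M → ℝ),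
      IsLinearOptical U ∧ IsSqueezing r S ∧ IsLinearOptical V ∧
      (Finset.univ.filter fun i => r i ≠ 0).card ≤ 2 * L ∧
      G₀⁻¹ * phaseShifter φ * G₀ = U * S * V) ∧
    ∃ W Z : Matrix (Fin M) (Fin M) ℂ,
      HasBogoliubov (G₀⁻¹ * phaseShifter φ * G₀) (1 + W) Z ∧
      W.rank ≤ 2 * L ∧ Z.rank ≤ 2 * L := by
  obtain ⟨A, B, hG⟩ := hG₀
  obtain ⟨W, Z, h, hW, hZ⟩ := hG.conj_phaseShifter φ
  have hL := Nat.mul_le_mul_left 2 hφ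
  obtain ⟨U, S, V, r, hU, hS, hV, hr, hUSV⟩ := h.exists_blochMessiah
  exact ⟨⟨U, S, V, r, hU, hS, hV, hr.trans (hZ.trans hL), hUSV⟩, W, Z, h, hW.trans hL, hZ.trans hL⟩
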